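/- Let $k$ be a field of characteristic zero, and let $W=k^2$ have standard basis $e_1,e_2$. Put $V_1=\mathrm{Sym}^4W$ with basis $m_i=e_1^{4-i}e_2^{i}$ $(0\le i\le 4)$, $V_2=\mathrm{Sym}^2W$ with basis $l_i=e_1^{2-i}e_2^{i}$ $(0\le i\le 2)$, and $V=\wedge^2V_1\otimes V_2$. Using these bases, let the algebraic $k$-group $G=\mathrm{GL}(V_1)\times\mathrm{GL}(V_2)=\mathrm{GL}(5)\times\mathrm{GL}(3)$ act on $V$ in the natural way. Let $$w=(m_0\wedge m_3-3\,m_1\wedge m_2)\otimes l_2+(-m_0\wedge m_4+2\,m_1\wedge m_3)\otimes l_1+(m_1\wedge m_4-3\,m_2\wedge m_3)\otimes l_0\in V,$$ let $G_w\subset G$ be its stabilizer (a closed $k$-subgroup), and let $G_w^0$ be the connected component of the identity of $G_w$ in the Zariski topology, an open subgroup scheme of $G_w$. Let $\mathrm{GL}(2)$ act on $V_1$ by $g\cdot x=(\det g)^{-2}\,\mathrm{Sym}^4(g)x$ and on $V_2$ by $g\cdot x=(\det g)^{-1}\,\mathrm{Sym}^2(g)x$. Scalar matrices act trivially, so this defines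 a homomorphism $\rho:\mathrm{PGL}(2)\to G$. Let $\tilde T=\{(tI_5,t^{-2}I_3)\mid t\in\mathrm{GL}(1)\}\subset G$. Then $\rho$ is an embedding, by which we regard $\mathrm{PGL}(2)$ as a subgroup of $G$; the map $t\mapsto(tI_5,t^{-2}I_3)$ is an isomorphism $\mathrm{GL}(1)\cong\tilde T$; the subgroups $\mathrm{PGL}(2)$ and $\tilde T$ commute and have trivial intersection; and $$G_w^0=\mathrm{PGL}(2)\times\tilde T$$ as algebraic subgroups of $G$ over $k$. That is, for every commutative $k$-algebra $R$, $G_w^0(R)$ is the internal direct product of the subgroups $\mathrm{PGL}(2)(R)$ and $\tilde T(R)$ of $G(R)$. In particular, if $R$ is a field or a local ring, then $G_w^0(R)=\rho(\mathrm{GL}_2(R)/R^\times)\cdot\tilde T(R)$. -/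

import Mathlib

open scoped TensorProduct MatrixGroups

noncomputable section

namespace GLFiveGLThree

/-! ### Symmetric powers of the standard representation of `GL(2)` -/

section Sym

variable {R : Type*} [CommRing R]

/-- The exponent of the monomial `e₁ ^ (d - i) * e₂ ^ i`. -/
def symExp (d i : ℕ) : Fin 2 →₀ ℕ :=
  Finsupp.single 0 (d - i) + Finsupp.single 1 i

/-- The basis vector `e₁ ^ (d - i) * e₂ ^ i` of `Sym^d W`, where `W = R²` has basis
`e₁ = X 0`, `e₂ = X 1` and the symmetric algebra of `W` is `R[e₁, e₂]`. -/
def symMon (R : Type*) [CommRing R] (d i : ℕ) : MvPolynomial (Fin 2) R :=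
  MvPolynomial.X 0 ^ (d - i) * MvPolynomial.X 1 ^ i

/-- The action of a `2 × 2` matrix `g` on the symmetric algebra of `W`:
`e₁ ↦ g₁₁ e₁ + g₂₁ e₂`, `e₂ ↦ g₁₂ e₁ + g₂₂ e₂`. -/
def symSubst (g : Matrix (Fin 2) (Fin 2) R) :
    MvPolynomial (Fin 2) R →ₐ[R] MvPolynomial (Fin 2) R :=
  MvPolynomial.aeval fun i => ∑ j, MvPolynomial.C (g j i) * MvPolynomial.X j

/-- The matrix of the usual action of `g` on `Sym^d W` in the basis
`e₁ ^ d, e₁ ^ (d - 1) e₂, …, e₂ ^ d`. -/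
def symMatrix (d : ℕ) (g : Matrix (Fin 2) (Fin 2) R) :
    Matrix (Fin (d + 1)) (Fin (d + 1)) R :=
  Matrix.of fun j i => MvPolynomial.coeff (symExp d j) (symSubst g (symMon R d i))

theorem symMon_eq (d i : ℕ) : symMon R d i = MvPolynomial.monomial (symExp d i) 1 := by
  simp only [symMon, symExp, MvPolynomial.X_pow_eq_monomial, MvPolynomial.monomial_mul, mul_one]

theorem symExp_inj {d i j : ℕ} (h : symExp d i = symExp d j) : i = j := by
  simpa [symExp] using DFunLike.congr_fun h 1

theorem symSubst_one : symSubst (1 : Matrix (Fin 2) (Fin 2) R) = AlgHom.id R _ := by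
  ext i : 1
  fin_cases i <;> simp [symSubst, Fin.sum_univ_two]

theorem symSubst_mul (g h : Matrix (Fin 2) (Fin 2) R) :
    symSubst (g * h) = (symSubst g).comp (symSubst h) := by
  ext i : 1
  simp only [symSubst, MvPolynomial.aeval_X, AlgHom.comp_apply, map_mul,
    Fin.sum_univ_two, Matrix.mul_apply, map_add, MvPolynomial.aeval_C,
    MvPolynomial.algebraMap_eq]
  ring

theorem symSubst_homogeneous (g : Matrix (Fin 2) (Fin 2) R) (d : ℕ) (i : Fin (d + 1)) :
    (symSubst g (symMon R d i)).IsHomogeneous d := by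
  have h : ∀ l : Fin 2, (symSubst g (MvPolynomial.X l)).IsHomogeneous 1 := by
    intro l
    simp only [symSubst, MvPolynomial.aeval_X]
    refine MvPolynomial.IsHomogeneous.sum _ _ _ fun j _ => ?_
    simpa using (MvPolynomial.isHomogeneous_C (Fin 2) (g j l)).mul
      (MvPolynomial.isHomogeneous_X R j)
  have h2 := ((h 0).pow (d - i)).mul ((h 1).pow i)
  have hd : 1 * (d - (i : ℕ)) + 1 * (i : ℕ) = d := by have := i.2; omega
  rw [hd] at h2
  simpa [symMon] using h2

theorem symSubst_symMon (g : Matrix (Fin 2) (Fin 2) R) (d : ℕ) (i : Fin (d + 1)) :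
    symSubst g (symMon R d i) = ∑ j, MvPolynomial.C (symMatrix d g j i) * symMon R d j := by
  ext s
  simp only [symMon_eq, MvPolynomial.coeff_sum, MvPolynomial.coeff_C_mul,
    MvPolynomial.coeff_monomial]
  by_cases hs : s 0 + s 1 = d
  · have hs' : symExp d (s 1) = s := by
      ext l
      fin_cases l
      · simp [symExp]; omega
      · simp [symExp]
    have hlt : s 1 < d + 1 := by omega
    rw [Finset.sum_eq_single (⟨s 1, hlt⟩ : Fin (d + 1))]
    · simp [hs', symMatrix, symMon_eq]
    · intro b _ hb
      have : symExp d b ≠ s := by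
        intro h
        exact hb (Fin.ext (symExp_inj (h.trans hs'.symm)))
      simp [this]
    · simp
  · have h0 : MvPolynomial.coeff s (symSubst g (symMon R d i)) = 0 := by
      refine (symSubst_homogeneous g d i).coeff_eq_zero ?_
      simpa [Finsupp.degree_eq_sum, Fin.sum_univ_two] using hs
    rw [symMon_eq] at h0
    rw [h0, Finset.sum_eq_zero]
    intro j _
    have : symExp d j ≠ s := by
      intro h
      apply hs
      rw [← h]
      have := j.2
      simp [symExp]
      omega
    simp [this]

theorem symMatrix_one (d : ℕ) : symMatrix d (1 : Matrix (Fin 2) (Fin 2) R) = 1 := by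
  ext j i
  simp only [symMatrix, Matrix.of_apply, symSubst_one, AlgHom.id_apply, symMon_eq,
    MvPolynomial.coeff_monomial, Matrix.one_apply]
  refine if_congr ⟨fun h => (Fin.ext (symExp_inj h)).symm, fun h => by rw [h]⟩ rfl rfl

theorem symMatrix_mul (d : ℕ) (g h : Matrix (Fin 2) (Fin 2) R) :
    symMatrix d (g * h) = symMatrix d g * symMatrix d h := by
  ext l i
  have e : symMatrix d (g * h) l i =
      MvPolynomial.coeff (symExp d l) (symSubst (g * h) (symMon R d i)) := rfl
  rw [e, symSubst_mul, AlgHom.comp_apply, symSubst_symMon h, map_sum, MvPolynomial.coeff_sum,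
    Matrix.mul_apply]
  refine Finset.sum_congr rfl fun j _ => ?_
  rw [map_mul, MvPolynomial.C_eq_smul_one, map_smul, map_one, smul_mul_assoc, one_mul,
    MvPolynomial.coeff_smul, smul_eq_mul, mul_comm]
  rfl

theorem symMatrix_map {S : Type*} [CommRing S] (f : R →+* S) (d : ℕ)
    (g : Matrix (Fin 2) (Fin 2) R) :
    symMatrix d (g.map f) = (symMatrix d g).map f := by
  ext j i
  simp only [symMatrix, Matrix.of_apply, Matrix.map_apply, symMon, symSubst, map_mul, map_pow,
    MvPolynomial.aeval_X, Fin.sum_univ_two, ← MvPolynomial.coeff_map, map_add,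
    MvPolynomial.map_C, MvPolynomial.map_X]

theorem symMatrix_scalar (d : ℕ) (a : R) :
    symMatrix d (Matrix.scalar (Fin 2) a) = Matrix.scalar (Fin (d + 1)) (a ^ d) := by
  ext j i
  have h : symSubst (Matrix.scalar (Fin 2) a) (symMon R d i) =
      MvPolynomial.C (a ^ d) * symMon R d i := by
    have hd : a ^ d = a ^ (d - (i : ℕ)) * a ^ (i : ℕ) := by
      rw [← pow_add]; congr 1; have := i.2; omega
    rw [hd]
    simp [symSubst, symMon, Matrix.scalar_apply, Fin.sum_univ_two, mul_pow]
    ring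
  have e : symMatrix d (Matrix.scalar (Fin 2) a) j i = MvPolynomial.coeff (symExp d j)
      (symSubst (Matrix.scalar (Fin 2) a) (symMon R d i)) := rfl
  rw [e, h, MvPolynomial.coeff_C_mul, symMon_eq, MvPolynomial.coeff_monomial,
    Matrix.scalar_apply, Matrix.diagonal_apply]
  by_cases hij : j = i
  · subst hij; simp
  · have : symExp d i ≠ symExp d j := fun h => hij (Fin.ext (symExp_inj h)).symm
    simp [hij, this]

/-- `Sym^d` of the standard representation of `GL(2)`, as a homomorphism to `GL(d + 1)`. -/
def symGL (R : Type*) [CommRing R] (d : ℕ) : GL (Fin 2) R →* GL (Fin (d + 1)) R :=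
  Units.map
    { toFun := symMatrix d
      map_one' := symMatrix_one d
      map_mul' := symMatrix_mul d }

/-- The twisted action `g · x = (det g)^{-n} g x` on `Sym^d W`. -/
def twistedSym (R : Type*) [CommRing R] (d n : ℕ) : GL (Fin 2) R →* GL (Fin (d + 1)) R where
  toFun g := Matrix.GeneralLinearGroup.scalar _ ((Matrix.GeneralLinearGroup.det g)⁻¹ ^ n) *
    symGL R d g
  map_one' := by simp
  map_mul' g h := by
    have hc := Matrix.GeneralLinearGroup.scalar_commute
      ((Matrix.GeneralLinearGroup.det h)⁻¹ ^ n) (symGL R d g)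
    rw [map_mul, map_mul, mul_inv, mul_pow, map_mul, mul_assoc, mul_assoc, ← mul_assoc _ _
      (symGL R d h), hc, mul_assoc]

/-- Scalar matrices act trivially on `Sym^{2n} W` twisted by `det^{-n}`. -/
theorem twistedSym_scalar {d n : ℕ} (hd : d = 2 * n) (u : Rˣ) :
    twistedSym R d n (Matrix.GeneralLinearGroup.scalar (Fin 2) u) = 1 := by
  have h1 : symGL R d (Matrix.GeneralLinearGroup.scalar (Fin 2) u) =
      Matrix.GeneralLinearGroup.scalar _ (u ^ d) :=
    Units.ext (symMatrix_scalar d (u : R))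
  have h2 : Matrix.GeneralLinearGroup.det (Matrix.GeneralLinearGroup.scalar (Fin 2) u) =
      u ^ 2 := by
    ext; simp
  change Matrix.GeneralLinearGroup.scalar _ _ * _ = 1
  rw [h1, h2, hd, ← map_mul, ← inv_pow, ← pow_mul, inv_pow, inv_mul_cancel, map_one]

theorem twistedSym_map {S : Type*} [CommRing S] (f : R →+* S) (d n : ℕ) (g : GL (Fin 2) R) :
    twistedSym S d n (Matrix.GeneralLinearGroup.map f g) =
      Matrix.GeneralLinearGroup.map f (twistedSym R d n g) := by
  have h1 : symGL S d (Matrix.GeneralLinearGroup.map f g) =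
      Matrix.GeneralLinearGroup.map f (symGL R d g) :=
    Units.ext (symMatrix_map f d (g : Matrix (Fin 2) (Fin 2) R))
  have h2 : ∀ u : Rˣ, Matrix.GeneralLinearGroup.map f
      (Matrix.GeneralLinearGroup.scalar (Fin (d + 1)) u) =
      Matrix.GeneralLinearGroup.scalar _ (Units.map (f : R →* S) u) := by
    intro u
    ext i j
    simp [Matrix.scalar_apply, Matrix.diagonal_apply, apply_ite f]
  have h3 : (Matrix.GeneralLinearGroup.det (Matrix.GeneralLinearGroup.map f g))⁻¹ ^ n =
      Units.map (f : R →* S) ((Matrix.GeneralLinearGroup.det g)⁻¹ ^ n) := by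
    rw [map_pow, map_inv, Matrix.GeneralLinearGroup.map_det]
  change Matrix.GeneralLinearGroup.scalar _ _ * _ =
    Matrix.GeneralLinearGroup.map f (Matrix.GeneralLinearGroup.scalar _ _ * _)
  rw [map_mul, h1, h2, h3]

end Sym

/-! ### The group `G`, the representation `V` and the point `w` -/

/-- The `R`-points of `G = GL(5) × GL(3)`. -/
abbrev G (R : Type*) [CommRing R] : Type _ := GL (Fin 5) R × GL (Fin 3) R

/-- The `R`-points of `V = ⋀² V₁ ⊗ V₂`, with `V₁ = R⁵` and `V₂ = R³`. -/
abbrev V (R : Type*) [CommRing R] : Type _ := (⋀[R]^2 (Fin 5 → R)) ⊗[R] (Fin 3 → R)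

/-- The natural action of `G` on `V`. -/
def rep (R : Type*) [CommRing R] : Representation R (G R) (V R) where
  toFun g := TensorProduct.map
    (exteriorPower.map 2 (Matrix.toLin' (g.1 : Matrix (Fin 5) (Fin 5) R)))
    (Matrix.toLin' (g.2 : Matrix (Fin 3) (Fin 3) R))
  map_one' := by
    simp only [Prod.fst_one, Prod.snd_one, Units.val_one, Matrix.toLin'_one,
      exteriorPower.map_id, TensorProduct.map_id]
    rfl
  map_mul' g h := by
    simp only [Prod.fst_mul, Prod.snd_mul, Units.val_mul, Matrix.toLin'_mul,
      exteriorPower.map_comp, TensorProduct.map_comp]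
    rfl

/-- The map on points of `G` induced by a ring homomorphism. -/
def mapG {R S : Type*} [CommRing R] [CommRing S] (f : R →+* S) : G R →* G S :=
  (Matrix.GeneralLinearGroup.map f).prodMap (Matrix.GeneralLinearGroup.map f)

/-- `mᵢ ∧ mⱼ`, where `m₀, …, m₄` is the standard basis of `V₁` (corresponding to the basis
`mᵢ = e₁ ^ (4 - i) e₂ ^ i` of `Sym⁴ W`). -/
def mWedge (R : Type*) [CommRing R] (i j : Fin 5) : ⋀[R]^2 (Fin 5 → R) :=
  exteriorPower.ιMulti R 2 ![Pi.single i 1, Pi.single j 1]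

/-- The standard basis `l₀, l₁, l₂` of `V₂` (corresponding to the basis
`lᵢ = e₁ ^ (2 - i) e₂ ^ i` of `Sym² W`). -/
def lVec (R : Type*) [CommRing R] (i : Fin 3) : Fin 3 → R := Pi.single i 1

/-- `w = (m₀∧m₃ - 3 m₁∧m₂) ⊗ l₂ + (-m₀∧m₄ + 2 m₁∧m₃) ⊗ l₁ + (m₁∧m₄ - 3 m₂∧m₃) ⊗ l₀`. -/
def w (R : Type*) [CommRing R] : V R :=
  (mWedge R 0 3 - (3 : R) • mWedge R 1 2) ⊗ₜ[R] lVec R 2 +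
    (-mWedge R 0 4 + (2 : R) • mWedge R 1 3) ⊗ₜ[R] lVec R 1 +
    (mWedge R 1 4 - (3 : R) • mWedge R 2 3) ⊗ₜ[R] lVec R 0

/-- The `R`-points of the stabilizer `G_w`. -/
def stabilizerW (R : Type*) [CommRing R] : Subgroup (G R) where
  carrier := {g | rep R g (w R) = w R}
  one_mem' := by simp
  mul_mem' {g h} hg hh := by
    change rep R (g * h) (w R) = w R
    rw [map_mul, Module.End.mul_apply, show rep R h (w R) = w R from hh]
    exact hg
  inv_mem' {g} hg := by
    calc rep R g⁻¹ (w R) = rep R g⁻¹ (rep R g (w R)) := by rw [show rep R g (w R) = w R from hg]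
      _ = w R := by simp

/-! ### The identity component of the algebraic group `G_w`

`G` is the open subscheme of the affine space with coordinate ring `CoordRing k` on which both
generic matrices are invertible, and `G_w` is a closed subscheme of `G`. Their underlying spaces
carry the subspace topology of the Zariski topology of the affine space. -/

/-- The coordinate ring of the space of pairs of a `5 × 5` and a `3 × 3` matrix. -/
abbrev CoordRing (k : Type*) [CommRing k] : Type _ :=
  MvPolynomial ((Fin 5 × Fin 5) ⊕ (Fin 3 × Fin 3)) k

/-- Evaluation of coordinate functions at an `R`-point of `G`. -/
def evalAt (k : Type*) [Field k] {R : Type*} [CommRing R] [Algebra k R] (g : G R) :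
    CoordRing k →ₐ[k] R :=
  MvPolynomial.aeval (Sum.elim (fun ij => g.1 ij.1 ij.2) (fun ij => g.2 ij.1 ij.2))

/-- The underlying topological space of `G_w`: the points `x` of the affine space for which the
tautological point with values in the residue field `κ(x)` is an element of `G_w(κ(x))`. -/
def stabilizerSpace (k : Type*) [Field k] : Set (PrimeSpectrum (CoordRing k)) :=
  {x | ∃ g ∈ stabilizerW x.asIdeal.ResidueField,
    ∀ f : CoordRing k, evalAt k g f = algebraMap (CoordRing k) x.asIdeal.ResidueField f}

/-- The identity of `G`, as a point of the affine space. -/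
def identityPoint (k : Type*) [Field k] : PrimeSpectrum (CoordRing k) :=
  PrimeSpectrum.comap (evalAt k (1 : G k)).toRingHom ⊥

/-- The underlying space of `G_w^0`: the connected component of the identity in `G_w`. -/
def identityComponentSpace (k : Type*) [Field k] : Set (PrimeSpectrum (CoordRing k)) :=
  connectedComponentIn (stabilizerSpace k) (identityPoint k)

/-- The `R`-points of the open subscheme `G_w^0` of `G_w`: those `R`-points `Spec R → G_w` whose
image is contained in the connected component of the identity. -/
def identityComponent (k : Type*) [Field k] (R : Type*) [CommRing R] [Algebra k R] :
    Set (G R) :=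
  {g | g ∈ stabilizerW R ∧ ∀ p : PrimeSpectrum R,
    PrimeSpectrum.comap (evalAt k g).toRingHom p ∈ identityComponentSpace k}

/-! ### The subgroups `PGL(2)` and `T̃` of `G` -/

/-- The homomorphism `GL(2) → G` given by the twisted actions on `Sym⁴ W` and `Sym² W`. -/
def rhoGL (R : Type*) [CommRing R] : GL (Fin 2) R →* G R :=
  (twistedSym R 4 2).prod (twistedSym R 2 1)

theorem rhoGL_scalar (R : Type*) [CommRing R] (u : Rˣ) :
    rhoGL R (Matrix.GeneralLinearGroup.scalar (Fin 2) u) = 1 := by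
  have h1 := twistedSym_scalar (d := 4) (n := 2) (by norm_num) u
  have h2 := twistedSym_scalar (d := 2) (n := 1) (by norm_num) u
  rw [rhoGL, MonoidHom.prod_apply, h1, h2]
  rfl

/-- The homomorphism `PGL(2, R) → G(R)` induced by `rhoGL`. -/
def rhoPGL (R : Type*) [CommRing R] : PGL(2, R) →* G R :=
  Matrix.ProjGenLinGroup.lift (rhoGL R) (MonoidHom.ext (rhoGL_scalar R))

theorem rhoGL_map {R S : Type*} [CommRing R] [CommRing S] (f : R →+* S) (h : GL (Fin 2) R) :
    rhoGL S (Matrix.GeneralLinearGroup.map f h) = mapG f (rhoGL R h) :=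
  Prod.ext (twistedSym_map f 4 2 h) (twistedSym_map f 2 1 h)

theorem exists_rhoPGL_map {R S : Type*} [CommRing R] [CommRing S] (f : R →+* S) (x : PGL(2, R)) :
    ∃ y : PGL(2, S), rhoPGL S y = mapG f (rhoPGL R x) := by
  obtain ⟨h, rfl⟩ := Matrix.ProjGenLinGroup.mk_surjective x
  exact ⟨.mk (Matrix.GeneralLinearGroup.map f h), rhoGL_map f h⟩

theorem away_refine_left {R : Type*} [CommRing R] (f f' : R) (g : G R)
    (h : ∃ x, mapG (algebraMap R (Localization.Away f)) g = rhoPGL _ x) :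
    ∃ x, mapG (algebraMap R (Localization.Away (f * f'))) g = rhoPGL _ x := by
  obtain ⟨x, hx⟩ := h
  let φ : Localization.Away f →+* Localization.Away (f * f') :=
    IsLocalization.Away.awayToAwayRight f f'
  have hφ : φ.comp (algebraMap R _) = algebraMap R _ :=
    RingHom.ext fun a => IsLocalization.Away.awayToAwayRight_eq f f' a
  obtain ⟨y, hy⟩ := exists_rhoPGL_map φ x
  refine ⟨y, ?_⟩
  rw [hy, ← hx, ← hφ]
  rfl

theorem away_refine_right {R : Type*} [CommRing R] (f f' : R) (g : G R)
    (h : ∃ x, mapG (algebraMap R (Localization.Away f')) g = rhoPGL _ x) :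
    ∃ x, mapG (algebraMap R (Localization.Away (f * f'))) g = rhoPGL _ x := by
  rw [mul_comm]
  exact away_refine_left f' f g h

/-- The `R`-points of the algebraic subgroup `PGL(2)` of `G`. The algebraic group
`PGL(2) = GL(2) / GL(1)` is the Zariski sheaf associated with `R ↦ GL₂(R) / Rˣ`
(`GL(1)`-torsors are locally trivial in the Zariski topology), so that an `R`-point of `G` belongs
to `PGL(2)` if and only if, locally on `Spec R`, it is the image of a class of an invertible
`2 × 2` matrix. -/
def pglSubgroup (R : Type*) [CommRing R] : Subgroup (G R) where
  carrier := {g | ∀ p : PrimeSpectrum R, ∃ f : R, f ∉ p.asIdeal ∧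
    ∃ x : PGL(2, Localization.Away f),
      mapG (algebraMap R (Localization.Away f)) g = rhoPGL (Localization.Away f) x}
  one_mem' p := ⟨1, p.isPrime.one_notMem, 1, by simp⟩
  mul_mem' {g h} hg hh p := by
    obtain ⟨f, hf, hx⟩ := hg p
    obtain ⟨f', hf', hx'⟩ := hh p
    obtain ⟨x, hx⟩ := away_refine_left f f' g hx
    obtain ⟨x', hx'⟩ := away_refine_right f f' h hx'
    exact ⟨f * f', p.isPrime.mul_notMem hf hf', x * x', by rw [map_mul, map_mul, hx, hx']⟩
  inv_mem' {g} hg p := by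
    obtain ⟨f, hf, x, hx⟩ := hg p
    exact ⟨f, hf, x⁻¹, by rw [map_inv, map_inv, hx]⟩

/-- The homomorphism `GL(1) → G`, `t ↦ (t I₅, t⁻² I₃)`. -/
def tauT (R : Type*) [CommRing R] : Rˣ →* G R :=
  (Matrix.GeneralLinearGroup.scalar (Fin 5)).prod
    ((Matrix.GeneralLinearGroup.scalar (Fin 3)).comp (zpowGroupHom (-2)))

/-- The `R`-points of the subgroup `T̃ = {(t I₅, t⁻² I₃)}` of `G`. -/
def torusSubgroup (R : Type*) [CommRing R] : Subgroup (G R) := (tauT R).range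

end GLFiveGLThree

end

open scoped Matrix

noncomputable section

namespace GLFiveGLThree

/-! ### Explicit matrices of the second and fourth symmetric powers -/

section SymExplicit

variable {R : Type*} [CommRing R]

/-! Write `w = ∑ ωₗ ⊗ lₗ` with bivectors `ωₗ`, and let `g = (A, h)` fix `w`. The idea is to recover
an invariant conic in the second factor. In the exterior algebra `ω₁² = 4 ω₀ω₂`, and up to scalars
this is the only quadratic relation among the `ωₗ` in characteristic zero. So `h` preserves the
discriminant form `y₁² - 4y₀y₂` up to a factor (`stabilizerW_discr`). The first column of `h` then
lies on the conic, and multiplying `g` by a lower unipotent element of `GL(2)` (after the Weyl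
element if `h₀₀` is not a unit) makes `h` upper triangular. The remaining equations say that `h` is
a scalar times `Sym²(x)/det x` for a triangular `x`. After dividing by `ρ(x)`, the second component
is a scalar `z`.

It remains to treat `z A Wₗ Aᵀ = Wₗ`, where `Wₗ` is the skew matrix of `ωₗ`. Then `Aᵀ` preserves the
kernel of every linear combination of the `Wₗ`, and a few explicit kernel vectors force `A` to be a
scalar `a` (`isScalar_of_conj_skewW`); finally `z a² = 1`. Conversely `w` is a
`GL(2)`-semi-invariant of weight `det⁵`, which the twists cancel.

All this needs only that 2, 3 and one of `h₀₀`, `h₂₀` be units. The last condition holds over a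
local ring, and locally on `Spec R` in general. The torus factor needs no gluing: the character
`(det A · det h)⁻¹` is trivial on `PGL(2)` and is the identity on `T̃ ≅ GL(1)`, so it gives that
factor globally. It also shows that the product is direct.

Finally `G_w` is already connected: by the case of fields, each of its points is a specialization of
the image of the generic point of `GL(2) × GL(1)`. Hence `G_w^0 = G_w`. -/

theorem symMatrix_apply_of_expansion {d : ℕ} {g : Matrix (Fin 2) (Fin 2) R} {i : Fin (d + 1)}
    (c : Fin (d + 1) → R)
    (h : symSubst g (symMon R d i) = ∑ j, MvPolynomial.C (c j) * symMon R d j)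
    (j : Fin (d + 1)) : symMatrix d g j i = c j := by
  have e : symMatrix d g j i = MvPolynomial.coeff (symExp d j) (symSubst g (symMon R d i)) := rfl
  rw [e, h, MvPolynomial.coeff_sum, Finset.sum_eq_single j]
  · simp [symMon_eq]
  · intro b _ hb
    have : symExp d b ≠ symExp d j := fun h => hb (Fin.ext (symExp_inj h))
    simp [symMon_eq, MvPolynomial.coeff_C_mul, MvPolynomial.coeff_monomial, this]
  · simp

/-- The explicit form of `symMatrix 2 !![p, q; r, s]`. -/
def symTwo (p q r s : R) : Matrix (Fin 3) (Fin 3) R :=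
  !![p ^ 2, p * q, q ^ 2;
     2 * p * r, p * s + q * r, 2 * q * s;
     r ^ 2, r * s, s ^ 2]

/-- The explicit form of `symMatrix 4 !![p, q; r, s]`. -/
def symFour (p q r s : R) : Matrix (Fin 5) (Fin 5) R :=
  !![p ^ 4, p ^ 3 * q, p ^ 2 * q ^ 2, p * q ^ 3, q ^ 4;
     4 * p ^ 3 * r, p ^ 3 * s + 3 * p ^ 2 * q * r, 2 * p ^ 2 * q * s + 2 * p * q ^ 2 * r,
       3 * p * q ^ 2 * s + q ^ 3 * r, 4 * q ^ 3 * s;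
     6 * p ^ 2 * r ^ 2, 3 * p ^ 2 * r * s + 3 * p * q * r ^ 2,
       p ^ 2 * s ^ 2 + 4 * p * q * r * s + q ^ 2 * r ^ 2,
       3 * p * q * s ^ 2 + 3 * q ^ 2 * r * s, 6 * q ^ 2 * s ^ 2;
     4 * p * r ^ 3, 3 * p * r ^ 2 * s + q * r ^ 3, 2 * p * r * s ^ 2 + 2 * q * r ^ 2 * s,
       p * s ^ 3 + 3 * q * r * s ^ 2, 4 * q * s ^ 3;
     r ^ 4, r ^ 3 * s, r ^ 2 * s ^ 2, r * s ^ 3, s ^ 4]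

theorem symMatrix_two (p q r s : R) : symMatrix 2 !![p, q; r, s] = symTwo p q r s := by
  ext j i
  rw [symMatrix_apply_of_expansion fun j => symTwo p q r s j i]
  fin_cases i <;>
  · simp [symTwo, symSubst, symMon, Fin.sum_univ_succ, map_ofNat MvPolynomial.C]
    ring

theorem symMatrix_four (p q r s : R) : symMatrix 4 !![p, q; r, s] = symFour p q r s := by
  ext j i
  rw [symMatrix_apply_of_expansion fun j => symFour p q r s j i]
  fin_cases i <;>
  · simp [symFour, symSubst, symMon, Fin.sum_univ_succ, map_ofNat MvPolynomial.C]
    ring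

end SymExplicit

/-! ### Skew matrices of `w` and its semi-invariance under `GL(2)` -/

section Equations

variable {R : Type*} [CommRing R]

/-- The skew-symmetric matrices `W₀, W₁, W₂` of coefficients of `w`: the coefficient of
`(mᵢ ∧ mⱼ) ⊗ lₗ`, `i < j`, in `w` is the entry `i, j` of `Wₗ`. -/
def skewW (R : Type*) [CommRing R] : Fin 3 → Matrix (Fin 5) (Fin 5) R :=
  ![!![0, 0, 0, 0, 0; 0, 0, 0, 0, 1; 0, 0, 0, -3, 0; 0, 0, 3, 0, 0; 0, -1, 0, 0, 0],
    !![0, 0, 0, 0, -1; 0, 0, 0, 2, 0; 0, 0, 0, 0, 0; 0, -2, 0, 0, 0; 1, 0, 0, 0, 0],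
    !![0, 0, 0, 1, 0; 0, 0, -3, 0, 0; 0, 3, 0, 0, 0; -1, 0, 0, 0, 0; 0, 0, 0, 0, 0]]

theorem skewW_map {S : Type*} [CommRing S] (f : R →+* S) (l : Fin 3) :
    (skewW R l).map f = skewW S l := by
  fin_cases l <;> · ext i j; fin_cases i <;> fin_cases j <;> simp [skewW, map_ofNat f]

/-- Expanding in 2 × 2 minors first keeps the entrywise verification of semi-invariance manageable.
-/
theorem skewW_zero_conj {n : Type*} (g : Matrix n (Fin 5) R) (i j : n) :
    (g * skewW R 0 * gᵀ) i j =
      g i 1 * g j 4 - g i 4 * g j 1 - 3 * (g i 2 * g j 3 - g i 3 * g j 2) := by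
  simp only [Matrix.mul_apply, Fin.sum_univ_five, skewW, Matrix.transpose_apply]
  simp
  ring

theorem skewW_one_conj {n : Type*} (g : Matrix n (Fin 5) R) (i j : n) :
    (g * skewW R 1 * gᵀ) i j =
      2 * (g i 1 * g j 3 - g i 3 * g j 1) - (g i 0 * g j 4 - g i 4 * g j 0) := by
  simp only [Matrix.mul_apply, Fin.sum_univ_five, skewW, Matrix.transpose_apply]
  simp
  ring

theorem skewW_two_conj {n : Type*} (g : Matrix n (Fin 5) R) (i j : n) :
    (g * skewW R 2 * gᵀ) i j =
      g i 0 * g j 3 - g i 3 * g j 0 - 3 * (g i 1 * g j 2 - g i 2 * g j 1) := by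
  simp only [Matrix.mul_apply, Fin.sum_univ_five, skewW, Matrix.transpose_apply]
  simp
  ring

-- Semi-invariance of `w`, checked entry by entry. The exponent is forced by degree: `⋀² Sym⁴ ⊗
-- Sym²` has degree 4 + 4 + 2 = 10 in the matrix entries, and the determinant has degree 2.
set_option maxHeartbeats 2000000 in
theorem symFour_conj_skewW (p q r s : R) (l : Fin 3) :
    ∑ m, symTwo p q r s l m • (symFour p q r s * skewW R m * (symFour p q r s)ᵀ) =
      (p * s - q * r) ^ 5 • skewW R l := by
  ext i j
  simp only [Fin.sum_univ_three, Matrix.add_apply, Matrix.smul_apply, skewW_zero_conj,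
    skewW_one_conj, skewW_two_conj, smul_eq_mul]
  fin_cases l <;>
  · fin_cases i <;> fin_cases j <;>
    · simp [skewW, symTwo, symFour]
      try ring

end Equations

/-! ### Bivectors as matrices, and the matrix equations of the stabilizer -/

section Bivectors

variable {R : Type*} [CommRing R]

/-- The bivector `∑ Aᵢⱼ mᵢ ∧ mⱼ`. -/
def bivector : Matrix (Fin 5) (Fin 5) R →ₗ[R] ⋀[R]^2 (Fin 5 → R) where
  toFun A := ∑ i, ∑ j, A i j • mWedge R i j
  map_add' A B := by simp only [Matrix.add_apply, add_smul, Finset.sum_add_distrib]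
  map_smul' c A := by
    simp only [Matrix.smul_apply, smul_assoc, Finset.smul_sum, RingHom.id_apply]

theorem bivector_apply (A : Matrix (Fin 5) (Fin 5) R) :
    bivector A = ∑ i, ∑ j, A i j • mWedge R i j := rfl

theorem ιMulti_pair (u v : Fin 5 → R) :
    exteriorPower.ιMulti R 2 ![u, v] = bivector (Matrix.vecMulVec u v) := by
  have hu : ∀ u : Fin 5 → R, u = ∑ i, u i • (Pi.single i 1 : Fin 5 → R) := fun u =>
    pi_eq_sum_univ' u |>.trans (by simp)
  have e0 : ∀ x y z : Fin 5 → R, Function.update ![x, y] 0 z = ![z, y] := fun x y z => by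
    ext a : 1; fin_cases a <;> simp
  have e1 : ∀ x y z : Fin 5 → R, Function.update ![x, y] 1 z = ![x, z] := fun x y z => by
    ext a : 1; fin_cases a <;> simp
  have h1 : ∀ v : Fin 5 → R, exteriorPower.ιMulti R 2 ![u, v] =
      ∑ i, u i • exteriorPower.ιMulti R 2 ![Pi.single i 1, v] := by
    intro v
    have h := map_sum ((exteriorPower.ιMulti R 2).toMultilinearMap.toLinearMap ![0, v] 0)
      (fun i => u i • (Pi.single i 1 : Fin 5 → R)) Finset.univ
    rw [← hu] at h
    simpa [e0] using h
  have h2 : ∀ i, exteriorPower.ιMulti R 2 ![Pi.single i 1, v] =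
      ∑ j, v j • mWedge R i j := by
    intro i
    have h := map_sum ((exteriorPower.ιMulti R 2).toMultilinearMap.toLinearMap
      ![(Pi.single i 1 : Fin 5 → R), 0] 1)
      (fun i => v i • (Pi.single i 1 : Fin 5 → R)) Finset.univ
    rw [← hu] at h
    simpa [e1, mWedge] using h
  rw [h1, bivector_apply]
  simp only [h2, Finset.smul_sum, smul_smul, Matrix.vecMulVec_apply]

/-- By linearity it is enough to look at matrix units, where `g Eᵢⱼ gᵀ` is the product of column `i`
of `g` with the transpose of column `j`. -/
theorem map_bivector (g A : Matrix (Fin 5) (Fin 5) R) :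
    exteriorPower.map 2 (Matrix.toLin' g) (bivector A) = bivector (g * A * gᵀ) := by
  have h : ∀ i j, exteriorPower.map 2 (Matrix.toLin' g) (mWedge R i j) =
      bivector (g * Matrix.single i j 1 * gᵀ) := by
    intro i j
    rw [mWedge, exteriorPower.map_apply_ιMulti]
    have : (Matrix.toLin' g ∘ ![Pi.single i 1, Pi.single j 1] : Fin 2 → Fin 5 → R) =
        ![g.col i, g.col j] := by
      ext a b; fin_cases a <;> simp
    rw [this, ιMulti_pair]
    congr 1
    ext a b
    simp [Matrix.mul_apply, Matrix.single_apply, Matrix.vecMulVec_apply, ite_and]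
  conv_rhs => rw [Matrix.matrix_eq_sum_single A]
  rw [bivector_apply]
  simp only [map_sum, map_smul, h, Matrix.mul_sum, Matrix.sum_mul]
  refine Finset.sum_congr rfl fun i _ => Finset.sum_congr rfl fun j _ => ?_
  rw [← map_smul]
  congr 1
  rw [← Matrix.smul_mul, ← Matrix.mul_smul, Matrix.smul_single, smul_eq_mul, mul_one]

/-- The coordinate `mᵢ* ∧ mⱼ*` of a bivector. -/
def bivectorCoord (i j : Fin 5) : (⋀[R]^2 (Fin 5 → R)) →ₗ[R] R :=
  exteriorPower.alternatingMapLinearEquiv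
    ((Matrix.detRowAlternating (n := Fin 2) (R := R)).compLinearMap
      (LinearMap.funLeft R R ![i, j]))

theorem bivectorCoord_bivector (i j : Fin 5) (A : Matrix (Fin 5) (Fin 5) R) :
    bivectorCoord i j (bivector A) = A i j - A j i := by
  have h : ∀ a b, bivectorCoord i j (mWedge R a b) =
      (if i = a then 1 else 0) * (if j = b then 1 else 0) -
        (if j = a then 1 else 0) * (if i = b then 1 else 0) := by
    intro a b
    rw [bivectorCoord, mWedge, exteriorPower.alternatingMapLinearEquiv_apply_ιMulti]
    refine (Matrix.det_fin_two (R := R) _).trans ?_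
    simp [LinearMap.funLeft, Pi.single_apply]
  simp [bivector_apply, h, mul_sub, Finset.sum_sub_distrib]

theorem mWedge_swap (i j : Fin 5) : mWedge R j i = -mWedge R i j := by
  have h := (exteriorPower.ιMulti R 2).map_swap
    ![(Pi.single i 1 : Fin 5 → R), Pi.single j 1] (i := 0) (j := 1) (by simp)
  rw [mWedge, mWedge, ← h]
  congr 1
  ext a : 1
  fin_cases a <;> simp

theorem bivector_transpose (A : Matrix (Fin 5) (Fin 5) R) : bivector Aᵀ = -bivector A := by
  simp only [bivector_apply, Matrix.transpose_apply]
  rw [Finset.sum_comm, ← Finset.sum_neg_distrib]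
  refine Finset.sum_congr rfl fun i _ => ?_
  rw [← Finset.sum_neg_distrib]
  exact Finset.sum_congr rfl fun j _ => by rw [mWedge_swap, smul_neg]

/-- The coordinates of a bivector see exactly `A - Aᵀ`. Conversely, for symmetric `A` the bivector
equals its own negative, which is where 2 must be invertible. -/
theorem bivector_eq_zero_iff (h2 : IsUnit (2 : R)) (A : Matrix (Fin 5) (Fin 5) R) :
    bivector A = 0 ↔ A - Aᵀ = 0 := by
  constructor
  · intro h
    ext i j
    have := bivectorCoord_bivector i j A
    rw [h, map_zero] at this
    exact this.symm
  · intro h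
    have h1 := bivector_transpose A
    rw [← sub_eq_zero.1 h, eq_neg_iff_add_eq_zero, ← two_smul R] at h1
    exact (h2.smul_eq_zero).1 h1

/-- Upper triangular matrices `U₀, U₁, U₂` for which `w = ∑ₗ Uₗ ⊗ lₗ`. -/
def upperW (R : Type*) [CommRing R] : Fin 3 → Matrix (Fin 5) (Fin 5) R :=
  ![Matrix.single 1 4 1 - (3 : R) • Matrix.single 2 3 1,
    -Matrix.single 0 4 1 + (2 : R) • Matrix.single 1 3 1,
    Matrix.single 0 3 1 - (3 : R) • Matrix.single 1 2 1]

theorem upperW_sub_transpose (l : Fin 3) : upperW R l - (upperW R l)ᵀ = skewW R l := by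
  fin_cases l <;>
  · ext i j; fin_cases i <;> fin_cases j <;> simp [skewW, upperW]

theorem bivector_single (i j : Fin 5) (c : R) :
    bivector (Matrix.single i j c) = c • mWedge R i j := by
  simp [bivector_apply, Matrix.single_apply, ite_and]

theorem w_eq_sum : w R = ∑ l, bivector (upperW R l) ⊗ₜ[R] lVec R l := by
  simp only [w, Fin.sum_univ_three, upperW]
  simp [bivector_single]
  abel

theorem piScalarRight_rep_w (g : G R) (l : Fin 3) :
    TensorProduct.piScalarRight R R _ (Fin 3) (rep R g (w R)) l =
      bivector (∑ m, (g.2 : Matrix (Fin 3) (Fin 3) R) l m •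
        ((g.1 : Matrix (Fin 5) (Fin 5) R) * upperW R m * (g.1 : Matrix (Fin 5) (Fin 5) R)ᵀ)) := by
  have h : rep R g (w R) = ∑ m, bivector ((g.1 : Matrix (Fin 5) (Fin 5) R) * upperW R m *
      (g.1 : Matrix (Fin 5) (Fin 5) R)ᵀ) ⊗ₜ[R] (g.2 : Matrix (Fin 3) (Fin 3) R).col m := by
    rw [w_eq_sum, map_sum]
    refine Finset.sum_congr rfl fun m _ => ?_
    change TensorProduct.map _ _ _ = _
    rw [TensorProduct.map_tmul, map_bivector]
    simp [lVec]
  rw [h, map_sum, Finset.sum_apply, map_sum]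
  refine Finset.sum_congr rfl fun m _ => ?_
  rw [TensorProduct.piScalarRight_apply, TensorProduct.piScalarRightHom_tmul, map_smul]
  rfl

/-- The equations of `G_w` in terms of matrices. -/
theorem mem_stabilizerW_iff (h2 : IsUnit (2 : R)) (g : G R) :
    g ∈ stabilizerW R ↔ ∀ l, ∑ m, (g.2 : Matrix (Fin 3) (Fin 3) R) l m •
      ((g.1 : Matrix (Fin 5) (Fin 5) R) * skewW R m * (g.1 : Matrix (Fin 5) (Fin 5) R)ᵀ) =
        skewW R l := by
  change rep R g (w R) = w R ↔ _
  rw [← (TensorProduct.piScalarRight R R _ (Fin 3)).injective.eq_iff, funext_iff]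
  refine forall_congr' fun l => ?_
  have h1 : TensorProduct.piScalarRight R R _ (Fin 3) (w R) l = bivector (upperW R l) := by
    have := piScalarRight_rep_w (1 : G R) l
    rw [map_one] at this
    simpa [Matrix.one_apply] using this
  rw [piScalarRight_rep_w, h1, ← sub_eq_zero, ← map_sub, bivector_eq_zero_iff h2,
    ← sub_eq_zero (b := skewW R l)]
  refine iff_of_eq (congrArg (· = 0) ?_)
  simp only [← upperW_sub_transpose, Matrix.transpose_sub, Matrix.transpose_sum,
    Matrix.transpose_smul, Matrix.transpose_mul, Matrix.transpose_transpose, Matrix.mul_sub,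
    Matrix.sub_mul, smul_sub, Finset.sum_sub_distrib, Matrix.mul_assoc]
  abel

end Bivectors

/-! ### The quadratic relation between the bivectors and the invariant conic -/

section Quadric

variable {R : Type*} [CommRing R]

theorem coe_exteriorPower_map {M N : Type*} [AddCommGroup M] [Module R M] [AddCommGroup N]
    [Module R N] (n : ℕ) (f : M →ₗ[R] N) (x : ⋀[R]^n M) :
    (exteriorPower.map n f x : ExteriorAlgebra R N) = ExteriorAlgebra.map f x := by
  have h : (⋀[R]^n N).subtype ∘ₗ exteriorPower.map n f =
      (ExteriorAlgebra.map f).toLinearMap ∘ₗ (⋀[R]^n M).subtype := by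
    ext m
    simp
  exact LinearMap.congr_fun h x

/-- The coordinate `mₐ* ∧ m_b* ∧ m_c* ∧ m_d*` on the exterior algebra. -/
def fourCoord (a b c d : Fin 5) : ExteriorAlgebra R (Fin 5 → R) →ₗ[R] R :=
  ExteriorAlgebra.liftAlternating (Function.update 0 4
    ((Matrix.detRowAlternating (n := Fin 4) (R := R)).compLinearMap
      (LinearMap.funLeft R R ![a, b, c, d])))

/-- Laplace expansion of a 4 × 4 determinant along its first two rows. Both sides are bilinear, so
decomposable bivectors suffice. -/
theorem fourCoord_mul (a b c d : Fin 5) (x y : ⋀[R]^2 (Fin 5 → R)) :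
    fourCoord a b c d ((x : ExteriorAlgebra R (Fin 5 → R)) * (y : ExteriorAlgebra R (Fin 5 → R))) =
      bivectorCoord a b x * bivectorCoord c d y - bivectorCoord a c x * bivectorCoord b d y +
      bivectorCoord a d x * bivectorCoord b c y + bivectorCoord b c x * bivectorCoord a d y -
      bivectorCoord b d x * bivectorCoord a c y + bivectorCoord c d x * bivectorCoord a b y := by
  have hx : x ∈ Submodule.span R (Set.range (exteriorPower.ιMulti R 2)) := by
    rw [exteriorPower.ιMulti_span]; trivial
  have hy : y ∈ Submodule.span R (Set.range (exteriorPower.ιMulti R 2)) := by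
    rw [exteriorPower.ιMulti_span]; trivial
  have hb : ∀ (i j : Fin 5) (u : Fin 2 → Fin 5 → R),
      bivectorCoord i j (exteriorPower.ιMulti R 2 u) = u 0 i * u 1 j - u 0 j * u 1 i := by
    intro i j u
    rw [bivectorCoord, exteriorPower.alternatingMapLinearEquiv_apply_ιMulti]
    refine (Matrix.det_fin_two (R := R) _).trans ?_
    simp [LinearMap.funLeft]
  induction hx using Submodule.span_induction with
  | zero => simp
  | add x x' _ _ hx hx' => simp only [Submodule.coe_add, add_mul, map_add, hx, hx']; ring
  | smul r x _ hx =>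
    simp only [Submodule.coe_smul, smul_mul_assoc, map_smul, hx, smul_eq_mul]; ring
  | mem x hx =>
    obtain ⟨u, rfl⟩ := hx
    induction hy using Submodule.span_induction with
    | zero => simp
    | add y y' _ _ hy hy' => simp only [Submodule.coe_add, mul_add, map_add, hy, hy']; ring
    | smul r y _ hy =>
      simp only [Submodule.coe_smul, mul_smul_comm, map_smul, hy, smul_eq_mul]; ring
    | mem y hy =>
      obtain ⟨v, rfl⟩ := hy
      rw [exteriorPower.ιMulti_apply_coe, exteriorPower.ιMulti_apply_coe,
        ExteriorAlgebra.ιMulti_mul_ιMulti, fourCoord,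
        ExteriorAlgebra.liftAlternating_apply_ιMulti]
      simp only [hb]
      simp only [Function.update_self, AlternatingMap.compLinearMap_apply]
      have hM : (fun i => LinearMap.funLeft R R ![a, b, c, d] (Fin.append u v i)) =
          !![u 0 a, u 0 b, u 0 c, u 0 d; u 1 a, u 1 b, u 1 c, u 1 d;
            v 0 a, v 0 b, v 0 c, v 0 d; v 1 a, v 1 b, v 1 c, v 1 d] := by
        ext i j
        fin_cases i <;> fin_cases j <;> rfl
      refine (congrArg (Matrix.det (R := R)) hM).trans ?_
      simp [Matrix.det_succ_row_zero, Fin.sum_univ_succ, Fin.succAbove]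
      ring

theorem mWedge_mul_mWedge (i j k l : Fin 5) :
    (mWedge R i j : ExteriorAlgebra R (Fin 5 → R)) *
      (mWedge R k l : ExteriorAlgebra R (Fin 5 → R)) =
      ExteriorAlgebra.ιMulti R 4 fun a => Pi.single (![i, j, k, l] a) 1 := by
  rw [mWedge, mWedge, exteriorPower.ιMulti_apply_coe, exteriorPower.ιMulti_apply_coe,
    ExteriorAlgebra.ιMulti_mul_ιMulti]
  congr 1
  ext a : 1
  fin_cases a <;> rfl

theorem mWedge_mul_mWedge_swap (i j k l : Fin 5) :
    (mWedge R i j : ExteriorAlgebra R (Fin 5 → R)) *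
      (mWedge R k l : ExteriorAlgebra R (Fin 5 → R)) =
      -((mWedge R k j : ExteriorAlgebra R (Fin 5 → R)) *
        (mWedge R i l : ExteriorAlgebra R (Fin 5 → R))) := by
  rw [mWedge_mul_mWedge, mWedge_mul_mWedge, ←
    (ExteriorAlgebra.ιMulti R (M := Fin 5 → R) 4).map_swap _
    (show (0 : Fin 4) ≠ 2 by decide)]
  congr 1
  ext a : 1
  fin_cases a <;> rfl

theorem mWedge_mul_mWedge_eq_zero {i j k l : Fin 5} (h : i = k ∨ i = l ∨ j = k ∨ j = l) :
    (mWedge R i j : ExteriorAlgebra R (Fin 5 → R)) *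
      (mWedge R k l : ExteriorAlgebra R (Fin 5 → R)) = 0 := by
  rw [mWedge_mul_mWedge]
  rcases h with rfl | rfl | rfl | rfl
  · exact AlternatingMap.map_eq_zero_of_eq _ _ (i := 0) (j := 2) rfl (by decide)
  · exact AlternatingMap.map_eq_zero_of_eq _ _ (i := 0) (j := 3) rfl (by decide)
  · exact AlternatingMap.map_eq_zero_of_eq _ _ (i := 1) (j := 2) rfl (by decide)
  · exact AlternatingMap.map_eq_zero_of_eq _ _ (i := 1) (j := 3) rfl (by decide)

/-- The bivector `ωₗ`, regarded as an element of the exterior algebra, where `w = ∑ₗ ωₗ ⊗ lₗ`. -/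
def omega (R : Type*) [CommRing R] (l : Fin 3) : ExteriorAlgebra R (Fin 5 → R) :=
  (bivector (upperW R l) : ⋀[R]^2 (Fin 5 → R))

/-- All products with a repeated index vanish. What survives on each side is a multiple of the
single 4-vector `m₁∧m₄∧m₀∧m₃`. -/
theorem omega_one_mul_omega_one :
    omega R 1 * omega R 1 = (4 : R) • (omega R 0 * omega R 2) := by
  have h0 : omega R 0 = (mWedge R 1 4 : ExteriorAlgebra R (Fin 5 → R)) -
      (3 : R) • (mWedge R 2 3 : ExteriorAlgebra R (Fin 5 → R)) := by
    simp [omega, upperW, bivector_single]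
  have h1 : omega R 1 = -(mWedge R 0 4 : ExteriorAlgebra R (Fin 5 → R)) +
      (2 : R) • (mWedge R 1 3 : ExteriorAlgebra R (Fin 5 → R)) := by
    simp [omega, upperW, bivector_single]
  have h2 : omega R 2 = (mWedge R 0 3 : ExteriorAlgebra R (Fin 5 → R)) -
      (3 : R) • (mWedge R 1 2 : ExteriorAlgebra R (Fin 5 → R)) := by
    simp [omega, upperW, bivector_single]
  have e1 := mWedge_mul_mWedge_swap (R := R) 0 4 1 3
  have e2 : (mWedge R 1 3 : ExteriorAlgebra R (Fin 5 → R)) *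
      (mWedge R 0 4 : ExteriorAlgebra R (Fin 5 → R)) = -((mWedge R 1 4 : ExteriorAlgebra R _) *
      (mWedge R 0 3 : ExteriorAlgebra R (Fin 5 → R))) := by
    rw [mWedge_mul_mWedge, mWedge_mul_mWedge, ←
      (ExteriorAlgebra.ιMulti R (M := Fin 5 → R) 4).map_swap _
      (show (1 : Fin 4) ≠ 3 by decide)]
    congr 1
    ext a : 1
    fin_cases a <;> rfl
  rw [h0, h1, h2]
  simp only [add_mul, mul_add, sub_mul, mul_sub, smul_mul_assoc, mul_smul_comm, neg_mul, mul_neg,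
    e1, e2, mWedge_mul_mWedge_eq_zero (R := R) (i := 0) (j := 4) (k := 0) (l := 4) (by decide),
    mWedge_mul_mWedge_eq_zero (R := R) (i := 1) (j := 3) (k := 1) (l := 3) (by decide),
    mWedge_mul_mWedge_eq_zero (R := R) (i := 1) (j := 4) (k := 1) (l := 2) (by decide),
    mWedge_mul_mWedge_eq_zero (R := R) (i := 2) (j := 3) (k := 0) (l := 3) (by decide),
    mWedge_mul_mWedge_eq_zero (R := R) (i := 2) (j := 3) (k := 1) (l := 2) (by decide)]
  module

theorem fourCoord_omega_mul_omega (a b c d : Fin 5) (m n : Fin 3) :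
    fourCoord a b c d (omega R m * omega R n) =
      skewW R m a b * skewW R n c d - skewW R m a c * skewW R n b d +
      skewW R m a d * skewW R n b c + skewW R m b c * skewW R n a d -
      skewW R m b d * skewW R n a c + skewW R m c d * skewW R n a b := by
  simp only [omega, fourCoord_mul, bivectorCoord_bivector, ← upperW_sub_transpose,
    Matrix.sub_apply, Matrix.transpose_apply]

theorem omega_eq_sum_map {g : G R} (hg : g ∈ stabilizerW R) (l : Fin 3) :
    omega R l = ∑ m, (g.2 : Matrix (Fin 3) (Fin 3) R) l m •
      ExteriorAlgebra.map (Matrix.toLin' (g.1 : Matrix (Fin 5) (Fin 5) R)) (omega R m) := by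
  have h := piScalarRight_rep_w g l
  have h1 := piScalarRight_rep_w (1 : G R) l
  rw [show rep R g (w R) = w R from hg] at h
  rw [map_one, Module.End.one_apply, h] at h1
  have h2 : bivector (upperW R l) = ∑ m, (g.2 : Matrix (Fin 3) (Fin 3) R) l m •
      exteriorPower.map 2 (Matrix.toLin' (g.1 : Matrix (Fin 5) (Fin 5) R))
        (bivector (upperW R m)) := by
    simp only [map_bivector, ← map_smul, ← map_sum]
    rw [h1]
    simp [Matrix.one_apply]
  rw [omega, h2]
  simp [coe_exteriorPower_map, omega]

/-- Substituting `ωₗ = ∑ hₗₘ g(ωₘ)` into `ω₁² = 4 ω₀ω₂` exhibits this sum as killed by the map that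
`g` induces on the exterior algebra, and that map is injective. -/
theorem sum_smul_omega_mul_omega {g : G R} (hg : g ∈ stabilizerW R) :
    ∑ m, ∑ n, ((g.2 : Matrix (Fin 3) (Fin 3) R) 1 m * (g.2 : Matrix (Fin 3) (Fin 3) R) 1 n -
      4 * ((g.2 : Matrix (Fin 3) (Fin 3) R) 0 m * (g.2 : Matrix (Fin 3) (Fin 3) R) 2 n)) •
        (omega R m * omega R n) = 0 := by
  have hinj : Function.Injective (ExteriorAlgebra.map
      (Matrix.toLin' (g.1 : Matrix (Fin 5) (Fin 5) R))) :=
    ExteriorAlgebra.map_injective ⟨Matrix.toLin' (g.1⁻¹ : GL (Fin 5) R).1, by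
      rw [← Matrix.toLin'_mul, ← Units.val_mul, inv_mul_cancel, Units.val_one,
        Matrix.toLin'_one]⟩
  apply hinj
  have h := omega_one_mul_omega_one (R := R)
  rw [← sub_eq_zero, omega_eq_sum_map hg 0, omega_eq_sum_map hg 1, omega_eq_sum_map hg 2] at h
  simp only [Finset.sum_mul_sum, Finset.smul_sum, ← Finset.sum_sub_distrib] at h
  rw [map_zero, map_sum, ← h]
  refine Finset.sum_congr rfl fun m _ => ?_
  rw [map_sum]
  refine Finset.sum_congr rfl fun n _ => ?_
  rw [map_smul, map_mul]
  simp only [smul_mul_assoc, mul_smul_comm]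
  module

/-- The discriminant form is preserved, up to a factor, by the second component of an element of
the stabilizer. -/
theorem stabilizerW_discr (h2 : IsUnit (2 : R)) (h3 : IsUnit (3 : R)) {g : G R}
    (hg : g ∈ stabilizerW R) {h : Matrix (Fin 3) (Fin 3) R} (hh : h = g.2) :
    h 1 0 ^ 2 = 4 * h 0 0 * h 2 0 ∧
    h 1 0 * h 1 1 = 2 * (h 0 0 * h 2 1 + h 0 1 * h 2 0) ∧
    h 1 0 * h 1 2 - 2 * (h 0 0 * h 2 2 + h 0 2 * h 2 0) +
      2 * (h 1 1 ^ 2 - 4 * h 0 1 * h 2 1) = 0 ∧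
    h 1 1 * h 1 2 = 2 * (h 0 1 * h 2 2 + h 0 2 * h 2 1) ∧
    h 1 2 ^ 2 = 4 * h 0 2 * h 2 2 := by
  have key : ∀ a b c d, ∑ m, ∑ n, (h 1 m * h 1 n - 4 * (h 0 m * h 2 n)) *
      (skewW R m a b * skewW R n c d - skewW R m a c * skewW R n b d +
      skewW R m a d * skewW R n b c + skewW R m b c * skewW R n a d -
      skewW R m b d * skewW R n a c + skewW R m c d * skewW R n a b) = 0 := by
    intro a b c d
    have := congrArg (fourCoord a b c d) (sum_smul_omega_mul_omega hg)
    rw [map_zero] at this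
    simpa only [map_sum, map_smul, smul_eq_mul, fourCoord_omega_mul_omega, ← hh] using this
  -- One coordinate of `⋀⁴` for each omitted index. Up to the units 2 and 6, each of them yields
  -- exactly one of the five equations.
  have k1 := key 1 2 3 4
  have k2 := key 0 2 3 4
  have k3 := key 0 1 3 4
  have k4 := key 0 1 2 4
  have k5 := key 0 1 2 3
  simp [Fin.sum_univ_three, skewW] at k1 k2 k3 k4 k5
  have h6 : IsUnit (2 * 3 : R) := h2.mul h3
  refine ⟨?_, ?_, ?_, ?_, ?_⟩
  · refine h6.mul_left_cancel ?_; linear_combination -k1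
  · refine h6.mul_left_cancel ?_; linear_combination k2
  · refine h2.mul_left_cancel ?_; linear_combination -k3
  · refine h6.mul_left_cancel ?_; linear_combination k4
  · refine h6.mul_left_cancel ?_; linear_combination -k5

end Quadric

/-! ### Elements of the stabilizer when a corner entry is a unit -/

section Points

variable {R : Type*} [CommRing R]

theorem rhoGL_fst (x : GL (Fin 2) R) :
    ((rhoGL R x).1 : Matrix (Fin 5) (Fin 5) R) =
      (((Matrix.GeneralLinearGroup.det x)⁻¹ ^ 2 : Rˣ) : R) •
        symFour (x 0 0) (x 0 1) (x 1 0) (x 1 1) := by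
  rw [← symMatrix_four, ← Matrix.eta_fin_two]
  exact (Matrix.smul_eq_diagonal_mul (m := Fin 5) (symMatrix 4 x.1) _).symm

theorem rhoGL_snd (x : GL (Fin 2) R) :
    ((rhoGL R x).2 : Matrix (Fin 3) (Fin 3) R) =
      (((Matrix.GeneralLinearGroup.det x)⁻¹ : Rˣ) : R) •
        symTwo (x 0 0) (x 0 1) (x 1 0) (x 1 1) := by
  rw [← symMatrix_two, ← Matrix.eta_fin_two, ← pow_one (Matrix.GeneralLinearGroup.det x)⁻¹]
  exact (Matrix.smul_eq_diagonal_mul (m := Fin 3) (symMatrix 2 x.1) _).symm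

theorem tauT_fst (t : Rˣ) :
    ((tauT R t).1 : Matrix (Fin 5) (Fin 5) R) = (t : R) • (1 : Matrix (Fin 5) (Fin 5) R) := by
  rw [Matrix.smul_one_eq_diagonal]; rfl

theorem tauT_snd (t : Rˣ) :
    ((tauT R t).2 : Matrix (Fin 3) (Fin 3) R) =
      ((t ^ (-2 : ℤ) : Rˣ) : R) • (1 : Matrix (Fin 3) (Fin 3) R) := by
  rw [Matrix.smul_one_eq_diagonal]; rfl

theorem rhoGL_mem_stabilizerW (h2 : IsUnit (2 : R)) (x : GL (Fin 2) R) :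
    rhoGL R x ∈ stabilizerW R := by
  rw [mem_stabilizerW_iff h2]
  intro l
  rw [rhoGL_fst, rhoGL_snd]
  have h := symFour_conj_skewW (x 0 0) (x 0 1) (x 1 0) (x 1 1) l
  rw [← Matrix.det_fin_two] at h
  have hd : ((Matrix.GeneralLinearGroup.det x : Rˣ) : R) =
      Matrix.det (x : Matrix (Fin 2) (Fin 2) R) := rfl
  rw [← hd] at h
  set d := Matrix.GeneralLinearGroup.det x
  -- The twists contribute `det⁻²` twice, through `A` and `Aᵀ`, and `det⁻¹` once, cancelling `det⁵`.
  have h5 : skewW R l = ((d⁻¹ ^ 5 : Rˣ) : R) • ((d : R) ^ 5 • skewW R l) := by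
    rw [smul_smul, ← Units.val_pow_eq_pow_val, ← Units.val_mul, ← mul_pow, inv_mul_cancel,
      one_pow, Units.val_one, one_smul]
  rw [h5, ← h, Finset.smul_sum]
  refine Finset.sum_congr rfl fun m _ => ?_
  simp only [Matrix.smul_apply, Matrix.transpose_smul, Matrix.smul_mul, Matrix.mul_smul,
    smul_smul, smul_eq_mul, Units.val_pow_eq_pow_val]
  congr 1
  ring

theorem tauT_mem_stabilizerW (h2 : IsUnit (2 : R)) (t : Rˣ) : tauT R t ∈ stabilizerW R := by
  rw [mem_stabilizerW_iff h2]
  intro l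
  rw [tauT_fst, tauT_snd]
  have h : ((t⁻¹ : Rˣ) : R) ^ 2 * (t * t) = 1 := by
    rw [← sq, ← mul_pow]; simp
  rw [Finset.sum_eq_single l]
  · simp [smul_smul]
    rw [h, one_smul]
  · intro m _ hm
    simp [hm.symm]
  · simp

theorem tauT_commute (t : Rˣ) (g : G R) : tauT R t * g = g * tauT R t :=
  Prod.ext (Matrix.GeneralLinearGroup.scalar_commute _ _)
    (Matrix.GeneralLinearGroup.scalar_commute _ _)

theorem mulVec_transpose_mulVec_eq_zero {n : Type*} [Fintype n] [DecidableEq n] {g : GL n R}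
    {A : Matrix n n R} {z : R} (hz : IsUnit z)
    (h : z • ((g : Matrix n n R) * A * (g : Matrix n n R)ᵀ) = A) {v : n → R} (hv : A *ᵥ v = 0) :
    A *ᵥ ((g : Matrix n n R)ᵀ *ᵥ v) = 0 := by
  rw [← h, Matrix.smul_mulVec, hz.smul_eq_zero, Matrix.mul_assoc, ← Matrix.mulVec_mulVec] at hv
  have h1 := congrArg (fun u => (g⁻¹ : GL n R).1 *ᵥ u) hv
  simp only [Matrix.mulVec_mulVec, Matrix.mulVec_zero, ← Matrix.mul_assoc] at h1
  rw [← Units.val_mul, inv_mul_cancel, Units.val_one, Matrix.one_mul] at h1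
  rw [Matrix.mulVec_mulVec, h1]

-- A skew 5 × 5 matrix is degenerate, and `gᵀ` preserves the kernel of each combination of the `Wₗ`.
-- The kernel vectors below force `e₀`, `e₂`, `e₄`, `3e₀ ± 3e₁ + 2e₂` and `2e₂ ± 3e₃ + 3e₄` to be
-- eigenvectors of `gᵀ`; comparing them makes all eigenvalues equal.
set_option maxHeartbeats 1000000 in
theorem isScalar_of_conj_skewW (h2 : IsUnit (2 : R)) (h3 : IsUnit (3 : R)) {g : GL (Fin 5) R}
    {z : R} (hz : IsUnit z)
    (h : ∀ l, z • ((g : Matrix (Fin 5) (Fin 5) R) * skewW R l *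
      (g : Matrix (Fin 5) (Fin 5) R)ᵀ) = skewW R l) :
    (g : Matrix (Fin 5) (Fin 5) R) = g 0 0 • (1 : Matrix (Fin 5) (Fin 5) R) := by
  have key : ∀ (c₀ c₁ c₂ : R) (v : Fin 5 → R),
      (c₀ • skewW R 0 + c₁ • skewW R 1 + c₂ • skewW R 2) *ᵥ v = 0 →
      ∀ i, ((c₀ • skewW R 0 + c₁ • skewW R 1 + c₂ • skewW R 2) *ᵥ
        ((g : Matrix (Fin 5) (Fin 5) R)ᵀ *ᵥ v)) i = 0 := by
    intro c₀ c₁ c₂ v hv i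
    refine congrFun (mulVec_transpose_mulVec_eq_zero hz ?_ hv) i
    conv_rhs => rw [← h 0, ← h 1, ← h 2]
    simp only [Matrix.mul_add, Matrix.add_mul, Matrix.mul_smul, Matrix.smul_mul, smul_add,
      smul_comm z]
  have c2 : ∀ {x : R}, 2 * x = 0 → x = 0 := fun {x} hx => (h2.mul_right_eq_zero).1 hx
  have c3 : ∀ {x : R}, 3 * x = 0 → x = 0 := fun {x} hx => (h3.mul_right_eq_zero).1 hx
  have k0 := key 1 0 0 ![1, 0, 0, 0, 0] (by
    ext i; fin_cases i <;> simp [Matrix.mulVec, dotProduct, Fin.sum_univ_succ, skewW])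
  have k1 := key 0 1 0 ![0, 0, 1, 0, 0] (by
    ext i; fin_cases i <;> simp [Matrix.mulVec, dotProduct, Fin.sum_univ_succ, skewW])
  have k2 := key 0 0 1 ![0, 0, 0, 0, 1] (by
    ext i; fin_cases i <;> simp [Matrix.mulVec, dotProduct, Fin.sum_univ_succ, skewW])
  have k3 := key 1 1 0 ![3, 3, 2, 0, 0] (by
    ext i; fin_cases i <;> simp [Matrix.mulVec, dotProduct, Fin.sum_univ_succ, skewW]; ring)
  have k4 := key 1 (-1) 0 ![3, -3, 2, 0, 0] (by
    ext i; fin_cases i <;> simp [Matrix.mulVec, dotProduct, Fin.sum_univ_succ, skewW]; ring)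
  have k5 := key 0 1 1 ![0, 0, 2, 3, 3] (by
    ext i; fin_cases i <;> simp [Matrix.mulVec, dotProduct, Fin.sum_univ_succ, skewW]; ring)
  have k6 := key 0 1 (-1) ![0, 0, 2, -3, 3] (by
    ext i; fin_cases i <;> simp [Matrix.mulVec, dotProduct, Fin.sum_univ_succ, skewW]; ring)
  generalize (g : Matrix (Fin 5) (Fin 5) R) = a at *
  simp [Matrix.mulVec, dotProduct, Fin.sum_univ_five, skewW, Fin.forall_fin_succ]
    at k0 k1 k2 k3 k4 k5 k6
  obtain ⟨a04, a03, a02, a01⟩ := k0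
  obtain ⟨a24, a23, a21, a20⟩ := k1
  obtain ⟨a43, a42, a41, a40⟩ := k2
  replace a03 := c3 a03
  replace a02 := c3 a02
  replace a23 := c2 a23
  replace a21 := c2 a21
  replace a42 := c3 a42
  replace a41 := c3 a41
  obtain ⟨p4, -, p3, p2, p0⟩ := k3
  obtain ⟨-, -, -, q2, q0⟩ := k4
  obtain ⟨r4, r2, r1, -, r0⟩ := k5
  obtain ⟨s4, s2, -, -, -⟩ := k6
  simp only [a04, a03, a02, a01, a24, a23, a21, a20, a43, a42, a41, a40]
    at p4 p3 p2 p0 q2 q0 r4 r2 r1 r0 s4 s2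
  have a14 : a 1 4 = 0 := c3 (by linear_combination -p4)
  have a13 : a 1 3 = 0 := c3 (c3 (by linear_combination p3))
  have a12 : a 1 2 = 0 := c2 (c3 (c3 (by linear_combination p2 - q2)))
  have a10 : a 1 0 = 0 := c2 (c3 (by linear_combination p0 + q0))
  have a11 : a 1 1 = a 0 0 := sub_eq_zero.1 (c2 (c3 (by linear_combination q0 - p0)))
  have a22 : a 2 2 = a 1 1 := sub_eq_zero.1 (c2 (c2 (c3 (by linear_combination p2 + q2))))
  have a34 : a 3 4 = 0 := c2 (c3 (by linear_combination s4 - r4))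
  have a44 : a 4 4 = a 3 3 := sub_eq_zero.1 (c2 (c3 (by linear_combination -s4 - r4)))
  have a32 : a 3 2 = 0 := c2 (c3 (c3 (by linear_combination -r2 - s2)))
  have a33 : a 3 3 = a 2 2 := sub_eq_zero.1 (c2 (c2 (c3 (by linear_combination r2 - s2))))
  have a31 : a 3 1 = 0 := c3 (c3 (by linear_combination r1))
  have a30 : a 3 0 = 0 := c3 (by linear_combination r0)
  ext i j
  fin_cases i <;> fin_cases j <;> simp [*]

theorem eq_tauT_of_snd_eq_scalar (h2 : IsUnit (2 : R)) (h3 : IsUnit (3 : R)) {g : G R}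
    (hg : g ∈ stabilizerW R) {z : Rˣ} (hz : g.2 = Matrix.GeneralLinearGroup.scalar (Fin 3) z) :
    ∃ t, g = tauT R t := by
  have hz' : (g.2 : Matrix (Fin 3) (Fin 3) R) = (z : R) • (1 : Matrix (Fin 3) (Fin 3) R) := by
    rw [hz, Matrix.smul_one_eq_diagonal]; rfl
  have h : ∀ l, (z : R) • ((g.1 : Matrix (Fin 5) (Fin 5) R) * skewW R l *
      (g.1 : Matrix (Fin 5) (Fin 5) R)ᵀ) = skewW R l := by
    intro l
    have := (mem_stabilizerW_iff h2 g).1 hg l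
    rw [hz', Finset.sum_eq_single l (fun m _ hm => by simp [hm.symm]) (by simp)] at this
    simpa using this
  have hs := isScalar_of_conj_skewW h2 h3 z.isUnit h
  have hzs : (z : R) * (g.1 0 0 * g.1 0 0) = 1 := by
    -- The entry `0, 3` of `W₂` is 1, so it reads off `z a² = 1`.
    have h1 := congrFun (congrFun (h 2) 0) 3
    rw [hs] at h1
    simpa [skewW] using h1
  let t : Rˣ := ⟨g.1 0 0, z * g.1 0 0, by linear_combination hzs, by linear_combination hzs⟩
  refine ⟨t, Prod.ext (Units.ext ?_) (Units.ext ?_)⟩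
  · rw [tauT_fst]; exact hs
  · rw [tauT_snd, hz']
    congr 2
    have ht : z * (t * t) = 1 := Units.ext hzs
    rw [eq_inv_of_mul_eq_one_left ht]
    group

theorem exists_of_triangular (h2 : IsUnit (2 : R)) (h3 : IsUnit (3 : R)) {g : G R}
    (hg : g ∈ stabilizerW R) (h00 : IsUnit (g.2 0 0)) (h10 : g.2 1 0 = 0) (h20 : g.2 2 0 = 0) :
    ∃ x t, g = rhoGL R x * tauT R t := by
  obtain ⟨-, e01, e11, e12, e22⟩ := stabilizerW_discr h2 h3 hg rfl
  rw [h10, h20] at e01 e11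
  have h4 : IsUnit (2 * 2 : R) := h2.mul h2
  have h21 : g.2 2 1 = 0 := by
    refine (h2.mul h00).mul_right_eq_zero.1 ?_
    linear_combination -e01
  rw [h21] at e11 e12
  have e11' : g.2 0 0 * g.2 2 2 = g.2 1 1 ^ 2 := h2.mul_left_cancel (by linear_combination -e11)
  have hdet : IsUnit (Matrix.det (g.2 : Matrix (Fin 3) (Fin 3) R)) :=
    (Matrix.isUnit_iff_isUnit_det _).1 g.2.isUnit
  have h11 : IsUnit (g.2 1 1) := by
    rw [Matrix.det_fin_three, h10, h20, h21] at hdet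
    refine isUnit_of_dvd_unit ⟨g.2 0 0 * g.2 2 2, ?_⟩ hdet
    ring
  obtain ⟨a, ha⟩ := h00
  obtain ⟨z, hz⟩ := h11
  have haa : (a : R) * (a⁻¹ : Rˣ) = 1 := a.mul_inv
  have hzz : (z : R) * (z⁻¹ : Rˣ) = 1 := z.mul_inv
  -- For triangular `x` the middle entry of `Sym²(x)/det x` is 1, so the scalar must be `z = h₁₁`.
  -- Normalising the last entry of `x` to 1, the first row of `h` determines the rest.
  let x : GL (Fin 2) R := Matrix.GeneralLinearGroup.mk''
    !![(a * z⁻¹ : R), g.2 0 1 * (z⁻¹ : Rˣ); 0, 1]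
    (by rw [Matrix.det_fin_two_of]; simp)
  have hx : Matrix.GeneralLinearGroup.det x = a * z⁻¹ := by
    ext
    change Matrix.det !![(a * z⁻¹ : R), g.2 0 1 * (z⁻¹ : Rˣ); 0, 1] = _
    rw [Matrix.det_fin_two_of]; simp
  have hx' : (x : Matrix (Fin 2) (Fin 2) R) = !![(a * z⁻¹ : R), g.2 0 1 * (z⁻¹ : Rˣ); 0, 1] := rfl
  rw [← ha, ← hz] at e11'
  rw [← hz] at e12
  have h22 : g.2 2 2 = z ^ 2 * (a⁻¹ : Rˣ) := by linear_combination (a⁻¹ : Rˣ) * e11' - g.2 2 2 * haa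
  have h12 : g.2 1 2 = 2 * g.2 0 1 * z * (a⁻¹ : Rˣ) := by
    rw [h22] at e12
    refine z.isUnit.mul_left_cancel ?_
    linear_combination e12
  have h02 : g.2 0 2 = g.2 0 1 ^ 2 * (a⁻¹ : Rˣ) := by
    rw [h22, h12] at e22
    refine (h4.mul ((z ^ 2 * a⁻¹ : Rˣ).isUnit)).mul_left_cancel ?_
    push_cast
    linear_combination -e22
  have hsnd : g.2 = (rhoGL R x).2 * Matrix.GeneralLinearGroup.scalar (Fin 3) z := by
    refine Units.ext ?_
    have hs : ((Matrix.GeneralLinearGroup.scalar (Fin 3) z : GL (Fin 3) R) :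
        Matrix (Fin 3) (Fin 3) R) = (z : R) • (1 : Matrix (Fin 3) (Fin 3) R) := by
      rw [Matrix.smul_one_eq_diagonal]; rfl
    rw [Units.val_mul, rhoGL_snd, hs, hx, Matrix.mul_smul, Matrix.mul_one, hx']
    ext i j
    fin_cases i <;> fin_cases j <;>
      simp [symTwo, ← ha, ← hz, h10, h20, h21, h02, h12, h22]
    · linear_combination -(a * z ^ 2 * (z⁻¹ : Rˣ) ^ 2 : R) * haa - a * (z * (z⁻¹ : Rˣ) + 1) * hzz
    · linear_combination -(g.2 0 1 * z ^ 2 * (z⁻¹ : Rˣ) ^ 2 : R) * haa -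
        g.2 0 1 * (z * (z⁻¹ : Rˣ) + 1) * hzz
    · linear_combination -(g.2 0 1 ^ 2 * (a⁻¹ : Rˣ) * (z * (z⁻¹ : Rˣ) + 1) : R) * hzz
    · linear_combination -(z ^ 2 * (z⁻¹ : Rˣ) : R) * haa - z * hzz
    · linear_combination -(2 * g.2 0 1 * z * (a⁻¹ : Rˣ) : R) * hzz
    · ring
  obtain ⟨t, ht⟩ := eq_tauT_of_snd_eq_scalar h2 h3 (g := (rhoGL R x)⁻¹ * g) (z := z)
    (mul_mem (inv_mem (rhoGL_mem_stabilizerW h2 x)) hg)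
    (by rw [Prod.snd_mul, hsnd, Prod.snd_inv, inv_mul_cancel_left])
  exact ⟨x, t, by rw [← ht, mul_inv_cancel_left]⟩

theorem exists_of_isUnit_zero (h2 : IsUnit (2 : R)) (h3 : IsUnit (3 : R)) {g : G R}
    (hg : g ∈ stabilizerW R) (h00 : IsUnit (g.2 0 0)) :
    ∃ x t, g = rhoGL R x * tauT R t := by
  obtain ⟨e00, -⟩ := stabilizerW_discr h2 h3 hg rfl
  obtain ⟨c, hc⟩ := h2.mul h00
  have hcc : (c : R) * (c⁻¹ : Rˣ) = 1 := c.mul_inv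
  -- The conic equation says that the first column is `h₀₀ · (1, 2r, r²)`, the image of `(e₁ + r
  -- e₂)²`. The unipotent matrix `y` moves `e₁ + r e₂` to `e₁`.
  set r : R := g.2 1 0 * (c⁻¹ : Rˣ) with hr
  have hr' : 2 * r * g.2 0 0 = g.2 1 0 := by
    rw [hr]
    linear_combination g.2 1 0 * hcc - g.2 1 0 * (c⁻¹ : Rˣ) * hc
  let y : GL (Fin 2) R := Matrix.GeneralLinearGroup.mk'' !![1, 0; -r, 1]
    (by rw [Matrix.det_fin_two_of]; simp)
  have hy : Matrix.GeneralLinearGroup.det y = 1 := by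
    ext
    change Matrix.det !![1, 0; -r, 1] = _
    rw [Matrix.det_fin_two_of]; simp
  have hy' : (y : Matrix (Fin 2) (Fin 2) R) = !![1, 0; -r, 1] := rfl
  have hsnd : (((rhoGL R y * g).2 : GL (Fin 3) R) : Matrix (Fin 3) (Fin 3) R) =
      symTwo 1 0 (-r) 1 * (g.2 : Matrix (Fin 3) (Fin 3) R) := by
    rw [Prod.snd_mul, Units.val_mul, rhoGL_snd, hy, hy']
    simp
  obtain ⟨x, t, hxt⟩ := exists_of_triangular h2 h3 (g := rhoGL R y * g)
    (mul_mem (rhoGL_mem_stabilizerW h2 y) hg)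
    (by rw [hsnd]; simpa [symTwo, Matrix.mul_apply, Fin.sum_univ_three] using h00)
    (by
      rw [hsnd]
      simp [symTwo, Matrix.mul_apply, Fin.sum_univ_three]
      linear_combination -hr')
    (by
      rw [hsnd]
      simp [symTwo, Matrix.mul_apply, Fin.sum_univ_three]
      refine (h2.mul (h2.mul h00)).mul_right_eq_zero.1 ?_
      -- Four `h₀₀` times the new corner entry is the square `(2r h₀₀ - h₁₀)²`, up to the conic
      -- equation.
      linear_combination -e00 + (2 * r * g.2 0 0 - g.2 1 0) * hr')
  refine ⟨y⁻¹ * x, t, ?_⟩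
  rw [map_mul, mul_assoc, ← hxt, map_inv, inv_mul_cancel_left]

theorem exists_of_isUnit_two (h2 : IsUnit (2 : R)) (h3 : IsUnit (3 : R)) {g : G R}
    (hg : g ∈ stabilizerW R) (h20 : IsUnit (g.2 2 0)) :
    ∃ x t, g = rhoGL R x * tauT R t := by
  -- The Weyl element, whose `Sym²` moves `h₂₀` to the top left corner.
  let y : GL (Fin 2) R := Matrix.GeneralLinearGroup.mk'' !![0, -1; 1, 0]
    (by rw [Matrix.det_fin_two_of]; simp)
  have hy : Matrix.GeneralLinearGroup.det y = 1 := by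
    ext
    change Matrix.det !![0, -1; 1, 0] = _
    rw [Matrix.det_fin_two_of]; simp
  have hy' : (y : Matrix (Fin 2) (Fin 2) R) = !![0, -1; 1, 0] := rfl
  obtain ⟨x, t, hxt⟩ := exists_of_isUnit_zero h2 h3 (g := rhoGL R y * g)
    (mul_mem (rhoGL_mem_stabilizerW h2 y) hg) (by
      rw [Prod.snd_mul, Units.val_mul, rhoGL_snd, hy, hy']
      simpa [symTwo, Matrix.mul_apply, Fin.sum_univ_three] using h20)
  refine ⟨y⁻¹ * x, t, ?_⟩
  rw [map_mul, mul_assoc, ← hxt, map_inv, inv_mul_cancel_left]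

/-- Otherwise `h₁₀² = 4h₀₀h₂₀` puts the whole first column in `p`, and with it the unit `det h`. -/
theorem zero_notMem_or_two_notMem (h2 : IsUnit (2 : R)) (h3 : IsUnit (3 : R)) {g : G R}
    (hg : g ∈ stabilizerW R) (p : Ideal R) [hp : p.IsPrime] : g.2 0 0 ∉ p ∨ g.2 2 0 ∉ p := by
  by_contra! h
  obtain ⟨h0, h2'⟩ := h
  obtain ⟨e00, -⟩ := stabilizerW_discr h2 h3 hg rfl
  have h1 : g.2 1 0 ∈ p := by
    refine hp.mem_of_pow_mem 2 ?_
    rw [e00]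
    exact p.mul_mem_left _ h2'
  refine hp.ne_top (p.eq_top_of_isUnit_mem ?_
    ((Matrix.isUnit_iff_isUnit_det _).1 g.2.isUnit))
  rw [Matrix.det_fin_three]
  have h := add_mem (add_mem
    (p.mul_mem_right (g.2 1 1 * g.2 2 2 - g.2 1 2 * g.2 2 1) h0)
    (p.mul_mem_right (g.2 0 2 * g.2 2 1 - g.2 0 1 * g.2 2 2) h1))
    (p.mul_mem_right (g.2 0 1 * g.2 1 2 - g.2 0 2 * g.2 1 1) h2')
  convert h using 1
  ring

end Points

/-! ### The character splitting off the torus, and injectivity -/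

section Character

variable {R S : Type*} [CommRing R] [CommRing S]

theorem det_symTwo (p q r s : R) : (symTwo p q r s).det = (p * s - q * r) ^ 3 := by
  rw [Matrix.det_fin_three]
  simp [symTwo]
  ring

set_option maxHeartbeats 4000000 in
theorem det_symFour (p q r s : R) : (symFour p q r s).det = (p * s - q * r) ^ 10 := by
  simp [symFour, Matrix.det_succ_row_zero, Fin.sum_univ_succ, Fin.succAbove]
  ring

theorem det_rhoGL_fst (x : GL (Fin 2) R) :
    Matrix.GeneralLinearGroup.det (rhoGL R x).1 = 1 := by
  ext
  have hd : ((Matrix.GeneralLinearGroup.det x : Rˣ) : R) =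
      Matrix.det (x : Matrix (Fin 2) (Fin 2) R) := rfl
  change Matrix.det ((rhoGL R x).1 : Matrix (Fin 5) (Fin 5) R) = _
  rw [rhoGL_fst, Matrix.det_smul, det_symFour, ← Matrix.det_fin_two, ← hd, Fintype.card_fin]
  rw [← Units.val_pow_eq_pow_val, ← Units.val_pow_eq_pow_val, ← Units.val_mul, ← pow_mul]
  simp

theorem det_rhoGL_snd (x : GL (Fin 2) R) :
    Matrix.GeneralLinearGroup.det (rhoGL R x).2 = 1 := by
  ext
  have hd : ((Matrix.GeneralLinearGroup.det x : Rˣ) : R) =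
      Matrix.det (x : Matrix (Fin 2) (Fin 2) R) := rfl
  change Matrix.det ((rhoGL R x).2 : Matrix (Fin 3) (Fin 3) R) = _
  rw [rhoGL_snd, Matrix.det_smul, det_symTwo, ← Matrix.det_fin_two, ← hd, Fintype.card_fin]
  rw [← Units.val_pow_eq_pow_val, ← Units.val_pow_eq_pow_val, ← Units.val_mul]
  simp

/-- The character `(g, h) ↦ (det g · det h)⁻¹` of `G`. It is trivial on `PGL(2)` and is the
projection onto `GL(1)` on `T̃`. -/
def detChar (R : Type*) [CommRing R] : G R →* Rˣ :=
  (Matrix.GeneralLinearGroup.det.coprod Matrix.GeneralLinearGroup.det)⁻¹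

theorem detChar_apply (g : G R) : detChar R g =
    (Matrix.GeneralLinearGroup.det g.1 * Matrix.GeneralLinearGroup.det g.2)⁻¹ := rfl

theorem detChar_rhoGL (x : GL (Fin 2) R) : detChar R (rhoGL R x) = 1 := by
  rw [detChar_apply, det_rhoGL_fst, det_rhoGL_snd, mul_one, inv_one]

theorem detChar_rhoPGL (x : PGL(2, R)) : detChar R (rhoPGL R x) = 1 := by
  obtain ⟨y, rfl⟩ := Matrix.ProjGenLinGroup.mk_surjective x
  exact detChar_rhoGL y

theorem detChar_tauT (t : Rˣ) : detChar R (tauT R t) = t := by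
  change (Matrix.GeneralLinearGroup.det (Matrix.GeneralLinearGroup.scalar (Fin 5) t) *
    Matrix.GeneralLinearGroup.det (Matrix.GeneralLinearGroup.scalar (Fin 3) (t ^ (-2 : ℤ))))⁻¹ = t
  rw [Matrix.GeneralLinearGroup.det_scalar, Matrix.GeneralLinearGroup.det_scalar,
    Fintype.card_fin, Fintype.card_fin]
  group

theorem detChar_mapG (f : R →+* S) (g : G R) :
    detChar S (mapG f g) = Units.map (f : R →* S) (detChar R g) := by
  rw [detChar_apply, detChar_apply, map_inv, map_mul, ← Matrix.GeneralLinearGroup.map_det,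
    ← Matrix.GeneralLinearGroup.map_det]
  rfl

theorem mapG_tauT (f : R →+* S) (t : Rˣ) :
    mapG f (tauT R t) = tauT S (Units.map (f : R →* S) t) := by
  refine Prod.ext (Matrix.GeneralLinearGroup.map_scalar f t) ?_
  refine (Matrix.GeneralLinearGroup.map_scalar f (t ^ (-2 : ℤ))).trans ?_
  rw [map_zpow]
  rfl

theorem tauT_injective : Function.Injective (tauT R) := fun s t h => by
  rw [← detChar_tauT s, h, detChar_tauT]

/-- The `Sym²` component suffices: `Sym²(y) = det y` makes the diagonal entries of `y` units, then
kills the off-diagonal ones, and `y₀₀² = det y = y₀₀y₁₁` gives equal diagonal entries. -/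
theorem rhoPGL_injective (h2 : IsUnit (2 : R)) : Function.Injective (rhoPGL R) := by
  rw [injective_iff_map_eq_one]
  intro x hx
  obtain ⟨y, rfl⟩ := Matrix.ProjGenLinGroup.mk_surjective x
  have hy : (rhoGL R y).2 = 1 := congrArg Prod.snd hx
  rw [Matrix.ProjGenLinGroup.mk_eq_one,
    Matrix.GeneralLinearGroup.mem_center_iff_val_mem_range_scalar]
  have h := rhoGL_snd y
  rw [hy] at h
  set d := Matrix.GeneralLinearGroup.det y
  have h' : symTwo (y 0 0) (y 0 1) (y 1 0) (y 1 1) = (d : R) • (1 : Matrix (Fin 3) (Fin 3) R) := by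
    rw [show (1 : Matrix (Fin 3) (Fin 3) R) = _ from h, smul_smul, ← Units.val_mul, mul_inv_cancel,
      Units.val_one, one_smul]
  have e (i j : Fin 3) := congrFun (congrFun h' i) j
  have e00 := e 0 0
  have e10 := e 1 0
  have e12 := e 1 2
  have e22 := e 2 2
  simp [symTwo] at e00 e10 e12 e22
  have hdd : (d : R) = y 0 0 * y 1 1 - y 0 1 * y 1 0 := Matrix.det_fin_two _
  have u0 : IsUnit (y 0 0) := (isUnit_pow_iff two_ne_zero).1 (e00 ▸ d.isUnit)
  have u1 : IsUnit (y 1 1) := (isUnit_pow_iff two_ne_zero).1 (e22 ▸ d.isUnit)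
  have y10 : y 1 0 = 0 := (h2.mul u0).mul_right_eq_zero.1 e10
  have y01 : y 0 1 = 0 := (h2.mul u1).mul_right_eq_zero.1 (by linear_combination e12)
  refine ⟨y 0 0, ?_⟩
  have y11 : y 1 1 = y 0 0 := u0.mul_left_cancel (by
    rw [y10] at hdd
    linear_combination -e00 - hdd)
  ext i j
  fin_cases i <;> fin_cases j <;> simp [*]

end Character

/-! ### Passage from localizations to arbitrary rings -/

section Local

variable {R S : Type*} [CommRing R] [CommRing S]

theorem eq_of_forall_exists_away {a b : R} (h : ∀ p : PrimeSpectrum R, ∃ f ∉ p.asIdeal,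
    algebraMap R (Localization.Away f) a = algebraMap R (Localization.Away f) b) : a = b := by
  rw [← sub_eq_zero]
  by_contra hab
  -- This kernel is the annihilator of `a - b`. It is proper if `a ≠ b`, yet a power of some `f`
  -- outside any given maximal ideal lies in it.
  have hI : LinearMap.ker (LinearMap.toSpanSingleton R R (a - b)) ≠ ⊤ := by
    rw [Ne, Ideal.eq_top_iff_one]
    simpa using hab
  obtain ⟨M, hM, hIM⟩ := Ideal.exists_le_maximal _ hI
  obtain ⟨f, hf, hfab⟩ := h ⟨M, hM.isPrime⟩
  rw [← sub_eq_zero, ← map_sub,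
    IsLocalization.map_eq_zero_iff (Submonoid.powers f) (Localization.Away f)] at hfab
  obtain ⟨⟨_, n, rfl⟩, hn⟩ := hfab
  exact hf (hM.isPrime.mem_of_pow_mem n (hIM (by simpa using hn)))

/-- The matrix of the `l`-th component of `g w - w`. -/
def stabDefect (g : G R) (l : Fin 3) : Matrix (Fin 5) (Fin 5) R :=
  ∑ m, (g.2 : Matrix (Fin 3) (Fin 3) R) l m •
    ((g.1 : Matrix (Fin 5) (Fin 5) R) * skewW R m * (g.1 : Matrix (Fin 5) (Fin 5) R)ᵀ) - skewW R l

theorem mem_stabilizerW_iff_stabDefect (h2 : IsUnit (2 : R)) (g : G R) :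
    g ∈ stabilizerW R ↔ ∀ l i j, stabDefect g l i j = 0 := by
  simp only [mem_stabilizerW_iff h2, ← sub_eq_zero (b := skewW R _), stabDefect, ← Matrix.ext_iff,
    Matrix.zero_apply]

theorem stabDefect_mapG (f : R →+* S) (g : G R) (l : Fin 3) (i j : Fin 5) :
    stabDefect (mapG f g) l i j = f (stabDefect g l i j) := by
  have h1 : ((mapG f g).1 : Matrix (Fin 5) (Fin 5) S) =
    (g.1 : Matrix (Fin 5) (Fin 5) R).map f := rfl
  have h2 : ((mapG f g).2 : Matrix (Fin 3) (Fin 3) S) =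
    (g.2 : Matrix (Fin 3) (Fin 3) R).map f := rfl
  simp only [stabDefect, h1, h2, ← skewW_map f, ← Matrix.transpose_map, ← Matrix.map_mul,
    Matrix.sub_apply, Matrix.sum_apply, Matrix.smul_apply, Matrix.map_apply, map_sub, map_sum,
    smul_eq_mul, map_mul]

theorem mapG_mem_stabilizerW (h2 : IsUnit (2 : R)) (f : R →+* S) {g : G R}
    (hg : g ∈ stabilizerW R) : mapG f g ∈ stabilizerW S := by
  have h2' : IsUnit (2 : S) := by simpa [map_ofNat f] using h2.map f
  rw [mem_stabilizerW_iff_stabDefect h2] at hg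
  rw [mem_stabilizerW_iff_stabDefect h2']
  intro l i j
  rw [stabDefect_mapG, hg, map_zero]

theorem mem_stabilizerW_of_mapG (h2 : IsUnit (2 : R)) {f : R →+* S}
    (hf : Function.Injective f) {g : G R} (hg : mapG f g ∈ stabilizerW S) :
    g ∈ stabilizerW R := by
  have h2' : IsUnit (2 : S) := by simpa [map_ofNat f] using h2.map f
  rw [mem_stabilizerW_iff_stabDefect h2'] at hg
  rw [mem_stabilizerW_iff_stabDefect h2]
  intro l i j
  apply hf
  rw [← stabDefect_mapG, hg, map_zero]

theorem rhoPGL_mem_stabilizerW (h2 : IsUnit (2 : R)) (x : PGL(2, R)) :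
    rhoPGL R x ∈ stabilizerW R := by
  obtain ⟨y, rfl⟩ := Matrix.ProjGenLinGroup.mk_surjective x
  exact rhoGL_mem_stabilizerW h2 y

theorem pglSubgroup_le_stabilizerW (h2 : IsUnit (2 : R)) : pglSubgroup R ≤ stabilizerW R := by
  intro g hg
  rw [mem_stabilizerW_iff_stabDefect h2]
  intro l i j
  refine eq_of_forall_exists_away fun p => ?_
  obtain ⟨f, hf, x, hx⟩ := hg p
  have h2' : IsUnit (2 : Localization.Away f) := by
    simpa [map_ofNat (algebraMap R (Localization.Away f))] using
        h2.map (algebraMap R (Localization.Away f))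
  refine ⟨f, hf, ?_⟩
  rw [← stabDefect_mapG, hx, map_zero]
  exact (mem_stabilizerW_iff_stabDefect h2' _).1 (rhoPGL_mem_stabilizerW h2' x) l i j

theorem detChar_of_mem_pglSubgroup {g : G R} (hg : g ∈ pglSubgroup R) : detChar R g = 1 := by
  refine Units.ext (eq_of_forall_exists_away fun p => ?_)
  obtain ⟨f, hf, x, hx⟩ := hg p
  refine ⟨f, hf, ?_⟩
  have h := detChar_mapG (algebraMap R (Localization.Away f)) g
  rw [hx, detChar_rhoPGL] at h
  rw [Units.val_one, map_one]
  exact (congrArg Units.val h).symm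

theorem pglSubgroup_inf_torusSubgroup : pglSubgroup R ⊓ torusSubgroup R = ⊥ := by
  rw [eq_bot_iff]
  rintro _ ⟨hp, t, rfl⟩
  have h := detChar_of_mem_pglSubgroup hp
  rw [detChar_tauT] at h
  rw [h, map_one]
  exact Subgroup.mem_bot.2 rfl

theorem mem_stabilizerW_iff_exists_mul (h2 : IsUnit (2 : R)) (h3 : IsUnit (3 : R)) (g : G R) :
    g ∈ stabilizerW R ↔ ∃ p ∈ pglSubgroup R, ∃ t ∈ torusSubgroup R, g = p * t := by
  constructor
  · intro hg
    -- The torus part is prescribed globally by the character, so only membership of the quotient in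
    -- `PGL(2)` has to be checked locally, on the principal opens of `h₀₀` and `h₂₀`.
    refine ⟨g * (tauT R (detChar R g))⁻¹, fun p => ?_, _, ⟨detChar R g, rfl⟩, by simp⟩
    have key : ∀ f, (f = g.2 0 0 ∨ f = g.2 2 0) → ∃ x : PGL(2, Localization.Away f),
        mapG (algebraMap R (Localization.Away f)) (g * (tauT R (detChar R g))⁻¹) =
          rhoPGL (Localization.Away f) x := by
      intro f hf
      have h2' : IsUnit (2 : Localization.Away f) := by
        simpa [map_ofNat (algebraMap R (Localization.Away f))] using
        h2.map (algebraMap R (Localization.Away f))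
      have h3' : IsUnit (3 : Localization.Away f) := by
        simpa [map_ofNat (algebraMap R (Localization.Away f))] using
        h3.map (algebraMap R (Localization.Away f))
      have hu := IsLocalization.Away.algebraMap_isUnit (S := Localization.Away f) f
      have hg' := mapG_mem_stabilizerW h2 (algebraMap R (Localization.Away f)) hg
      obtain ⟨x, t, hxt⟩ : ∃ x t, mapG (algebraMap R (Localization.Away f)) g =
          rhoGL _ x * tauT _ t := by
        rcases hf with hf | hf
        · refine exists_of_isUnit_zero h2' h3' hg' ?_
          change IsUnit (algebraMap R (Localization.Away f) (g.2 0 0))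
          rwa [← hf]
        · refine exists_of_isUnit_two h2' h3' hg' ?_
          change IsUnit (algebraMap R (Localization.Away f) (g.2 2 0))
          rwa [← hf]
      refine ⟨.mk x, ?_⟩
      rw [map_mul, map_inv, mapG_tauT, ← detChar_mapG, hxt, map_mul, detChar_rhoGL, detChar_tauT,
        one_mul, mul_inv_cancel_right]
      rfl
    rcases zero_notMem_or_two_notMem h2 h3 hg p.asIdeal with hp | hp
    · exact ⟨_, hp, key _ (Or.inl rfl)⟩
    · exact ⟨_, hp, key _ (Or.inr rfl)⟩
  · rintro ⟨p, hp, _, ⟨t, rfl⟩, rfl⟩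
    exact mul_mem (pglSubgroup_le_stabilizerW h2 hp) (tauT_mem_stabilizerW h2 t)

theorem exists_rhoGL_mul_tauT [IsLocalRing R] (h2 : IsUnit (2 : R)) (h3 : IsUnit (3 : R)) {g : G R}
    (hg : g ∈ stabilizerW R) : ∃ x t, g = rhoGL R x * tauT R t := by
  rcases zero_notMem_or_two_notMem h2 h3 hg (IsLocalRing.maximalIdeal R) with h | h
  · exact exists_of_isUnit_zero h2 h3 hg (by simpa using h)
  · exact exists_of_isUnit_two h2 h3 hg (by simpa using h)

end Local

/-! ### Connectedness of the stabilizer -/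

section Connected

variable (k : Type*) [Field k]

theorem isUnit_ofNat_of_algebra [CharZero k] (R : Type*) [CommRing R] [Algebra k R] (n : ℕ)
    [n.AtLeastTwo] : IsUnit (OfNat.ofNat n : R) := by
  have h : IsUnit (OfNat.ofNat n : k) := (OfNat.ofNat_ne_zero n).isUnit
  simpa [map_ofNat (algebraMap k R)] using h.map (algebraMap k R)

theorem evalAt_mapG {R S : Type*} [CommRing R] [CommRing S] [Algebra k R] [Algebra k S]
    (f : R →ₐ[k] S) (g : G R) : evalAt k (mapG (f : R →+* S) g) = f.comp (evalAt k g) := by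
  refine MvPolynomial.algHom_ext fun i => ?_
  rcases i with i | i
  · simp [evalAt]; rfl
  · simp [evalAt]; rfl

/-- The residue field of the image point embeds in that of `p`, and the tautological matrices become
the reduction of `g` there. Invertibility and the stabilizer equations descend along this injection.
-/
theorem comap_evalAt_mem_stabilizerSpace [CharZero k] {R : Type*} [CommRing R] [Algebra k R]
    {g : G R} (hg : g ∈ stabilizerW R) (p : PrimeSpectrum R) :
    PrimeSpectrum.comap (evalAt k g).toRingHom p ∈ stabilizerSpace k := by
  set x := PrimeSpectrum.comap (evalAt k g).toRingHom p with hx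
  let ψ : x.asIdeal.ResidueField →+* p.asIdeal.ResidueField :=
    Ideal.ResidueField.map x.asIdeal p.asIdeal (evalAt k g).toRingHom rfl
  have hψ : ∀ f, ψ (algebraMap _ _ f) = algebraMap R p.asIdeal.ResidueField (evalAt k g f) :=
    fun f => Ideal.ResidueField.map_algebraMap ..
  let A : Matrix (Fin 5) (Fin 5) x.asIdeal.ResidueField :=
    Matrix.of fun i j => algebraMap (CoordRing k) _ (MvPolynomial.X (Sum.inl (i, j)))
  let B : Matrix (Fin 3) (Fin 3) x.asIdeal.ResidueField :=
    Matrix.of fun i j => algebraMap (CoordRing k) _ (MvPolynomial.X (Sum.inr (i, j)))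
  have hA : A.map ψ = (g.1 : Matrix (Fin 5) (Fin 5) R).map
      (algebraMap R p.asIdeal.ResidueField) := by
    ext i j
    simp [A, hψ, evalAt]
  have hB : B.map ψ = (g.2 : Matrix (Fin 3) (Fin 3) R).map
      (algebraMap R p.asIdeal.ResidueField) := by
    ext i j
    simp [B, hψ, evalAt]
  have isUnit_det : ∀ {n : ℕ} (M : Matrix (Fin n) (Fin n) x.asIdeal.ResidueField)
      (γ : GL (Fin n) R),
      M.map ψ = (γ : Matrix (Fin n) (Fin n) R).map (algebraMap R p.asIdeal.ResidueField) →
      IsUnit M.det := by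
    intro n M γ h
    have h1 : ψ M.det = algebraMap R p.asIdeal.ResidueField (γ : Matrix (Fin n) (Fin n) R).det := by
      rw [RingHom.map_det, RingHom.map_det]
      exact congrArg Matrix.det h
    have h2 := ((Matrix.isUnit_iff_isUnit_det _).1 γ.isUnit).map
      (algebraMap R p.asIdeal.ResidueField)
    rw [← h1] at h2
    refine isUnit_iff_ne_zero.2 fun h0 => ?_
    rw [h0, map_zero] at h2
    exact not_isUnit_zero h2
  let g' : G x.asIdeal.ResidueField := (Matrix.GeneralLinearGroup.mk'' A (isUnit_det A g.1 hA),
    Matrix.GeneralLinearGroup.mk'' B (isUnit_det B g.2 hB))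
  have hg' : mapG ψ g' = mapG (algebraMap R p.asIdeal.ResidueField) g :=
    Prod.ext (Units.ext hA) (Units.ext hB)
  refine ⟨g', mem_stabilizerW_of_mapG (isUnit_ofNat_of_algebra k _ 2) ψ.injective ?_, fun f => ?_⟩
  · rw [hg']
    exact mapG_mem_stabilizerW (isUnit_ofNat_of_algebra k _ 2) _ hg
  · have : evalAt k g' = IsScalarTower.toAlgHom k (CoordRing k) x.asIdeal.ResidueField := by
      refine MvPolynomial.algHom_ext fun i => ?_
      rcases i with i | i
      · simp [evalAt]; rfl
      · simp [evalAt]; rfl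
    rw [this]
    rfl

/-- The polynomial ring over which the generic `2 × 2` matrix and the generic scalar live. -/
abbrev GenericPoly : Type _ := MvPolynomial ((Fin 2 × Fin 2) ⊕ Unit) k

/-- The generic `2 × 2` matrix. -/
def genericMatrix : Matrix (Fin 2) (Fin 2) (GenericPoly k) :=
  Matrix.of fun i j => MvPolynomial.X (Sum.inl (i, j))

/-- The product of the determinant of the generic matrix and the generic scalar. -/
def genericDenom : GenericPoly k := (genericMatrix k).det * MvPolynomial.X (Sum.inr ())

/-- The coordinate ring of `GL(2) × GL(1)`. -/
abbrev GenericRing : Type _ := Localization.Away (genericDenom k)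

theorem genericDenom_ne_zero : genericDenom k ≠ 0 := by
  intro h
  have h1 := congrArg (MvPolynomial.aeval (R := k) (S₁ := k)
    (Sum.elim (fun ij => (1 : Matrix (Fin 2) (Fin 2) k) ij.1 ij.2) fun _ => 1)) h
  simp [genericDenom, genericMatrix, Matrix.det_fin_two] at h1

instance : IsDomain (GenericRing k) :=
  IsLocalization.isDomain_localization
    (powers_le_nonZeroDivisors_of_noZeroDivisors (genericDenom_ne_zero k))

theorem isUnit_genericDenom :
    IsUnit (algebraMap (GenericPoly k) (GenericRing k) (genericDenom k)) :=
  IsLocalization.Away.algebraMap_isUnit _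

/-- The generic point of `GL(2)`. -/
def genericGL : GL (Fin 2) (GenericRing k) :=
  Matrix.GeneralLinearGroup.mk'' ((algebraMap (GenericPoly k) (GenericRing k)).mapMatrix
      (genericMatrix k)) (by
    have h : IsUnit (algebraMap (GenericPoly k) (GenericRing k)
        ((genericMatrix k).det * MvPolynomial.X (Sum.inr ()))) := isUnit_genericDenom k
    rw [map_mul] at h
    rw [← RingHom.map_det]
    exact isUnit_of_mul_isUnit_left h)

theorem isUnit_genericScalar : IsUnit (algebraMap (GenericPoly k) (GenericRing k)
    (MvPolynomial.X (Sum.inr ()))) := by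
  have h : IsUnit (algebraMap (GenericPoly k) (GenericRing k)
      ((genericMatrix k).det * MvPolynomial.X (Sum.inr ()))) := isUnit_genericDenom k
  rw [map_mul] at h
  exact isUnit_of_mul_isUnit_right h

/-- The generic point of `GL(1)`. -/
def genericScalar : (GenericRing k)ˣ := (isUnit_genericScalar k).unit

/-- The image in `G` of the generic point of `GL(2) × GL(1)`. -/
def genericG : G (GenericRing k) :=
  rhoGL _ (genericGL k) * tauT _ (genericScalar k)

theorem exists_specialization {S : Type*} [CommRing S] [Algebra k S] (h : GL (Fin 2) S) (t : Sˣ) :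
    ∃ χ : GenericRing k →ₐ[k] S,
      mapG (χ : GenericRing k →+* S) (genericG k) = rhoGL S h * tauT S t := by
  let φ : GenericPoly k →ₐ[k] S :=
    MvPolynomial.aeval (Sum.elim (fun ij => h ij.1 ij.2) fun _ => (t : S))
  have hφm : (genericMatrix k).map φ = (h : Matrix (Fin 2) (Fin 2) S) := by
    ext i j
    simp [genericMatrix, φ]
  have hφ : IsUnit (φ (genericDenom k)) := by
    have h1 : φ (genericMatrix k).det = (h : Matrix (Fin 2) (Fin 2) S).det := by
      rw [AlgHom.map_det]
      exact congrArg Matrix.det hφm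
    rw [genericDenom, map_mul, h1]
    refine ((Matrix.isUnit_iff_isUnit_det _).1 h.isUnit).mul ?_
    simp [φ]
  let χ : GenericRing k →ₐ[k] S := IsLocalization.Away.liftAlgHom (genericDenom k) hφ
  have hχ : ∀ a, χ (algebraMap _ _ a) = φ a := fun a => IsLocalization.Away.lift_eq _ hφ a
  have h1 : Matrix.GeneralLinearGroup.map (χ : GenericRing k →+* S) (genericGL k) = h := by
    refine Units.ext (Eq.trans ?_ hφm)
    ext i j
    exact hχ _
  have h2 : Units.map ((χ : GenericRing k →+* S) : GenericRing k →* S) (genericScalar k) = t := by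
    ext
    refine (hχ _).trans ?_
    simp [φ]
  refine ⟨χ, ?_⟩
  rw [genericG, map_mul, ← rhoGL_map, mapG_tauT, h1, h2]

/-- The space lies between a single point, the image of the generic point of `GL(2) × GL(1)`, and
the closure of that point. -/
theorem isPreconnected_stabilizerSpace [CharZero k] : IsPreconnected (stabilizerSpace k) := by
  have hmem : genericG k ∈ stabilizerW (GenericRing k) :=
    mul_mem (rhoGL_mem_stabilizerW (isUnit_ofNat_of_algebra k _ 2) _)
      (tauT_mem_stabilizerW (isUnit_ofNat_of_algebra k _ 2) _)
  refine (isPreconnected_singleton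
    (x := PrimeSpectrum.comap (evalAt k (genericG k)).toRingHom ⊥)).subset_closure
    (Set.singleton_subset_iff.2 (comap_evalAt_mem_stabilizerSpace k hmem ⊥)) ?_
  rintro x ⟨g, hg, hgx⟩
  rw [← PrimeSpectrum.le_iff_mem_closure]
  -- A residue field is a local ring, so the tautological point lifts to `GL(2) × GL(1)` with no
  -- field extension. It is then a specialization of the generic point, and polynomials vanishing at
  -- the latter vanish at `x`.
  obtain ⟨h, t, rfl⟩ := exists_rhoGL_mul_tauT (isUnit_ofNat_of_algebra k _ 2)
    (isUnit_ofNat_of_algebra k _ 3) hg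
  obtain ⟨χ, hχ⟩ := exists_specialization k h t
  intro f hf
  have hf' : evalAt k (genericG k) f = 0 := hf
  have h0 := hgx f
  rw [← hχ, evalAt_mapG, AlgHom.comp_apply, hf', map_zero] at h0
  exact Ideal.algebraMap_residueField_eq_zero.1 h0.symm

theorem identityComponent_eq_stabilizerW [CharZero k] (R : Type*) [CommRing R] [Algebra k R] :
    identityComponent k R = stabilizerW R := by
  have h : identityComponentSpace k = stabilizerSpace k :=
    (isPreconnected_stabilizerSpace k).connectedComponentIn
      (comap_evalAt_mem_stabilizerSpace k (one_mem _) ⊥)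
  ext g
  refine ⟨fun hg => hg.1, fun hg => ⟨hg, fun p => ?_⟩⟩
  rw [h]
  exact comap_evalAt_mem_stabilizerSpace k hg p

end Connected
end GLFiveGLThree

end

theorem mainTheorem6 (k : Type*) [Field k] [CharZero k] (R : Type*) [CommRing R] [Algebra k R] :
    -- `G_w^0 = PGL(2) · T̃`, on points with values in an arbitrary `k`-algebra `R`
    GLFiveGLThree.identityComponent k R =
        {g | ∃ p ∈ GLFiveGLThree.pglSubgroup R, ∃ t ∈ GLFiveGLThree.torusSubgroup R,
          g = p * t} ∧
      -- the product is direct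
      (∀ p ∈ GLFiveGLThree.pglSubgroup R, ∀ t ∈ GLFiveGLThree.torusSubgroup R,
        p * t = t * p) ∧
      GLFiveGLThree.pglSubgroup R ⊓ GLFiveGLThree.torusSubgroup R = ⊥ ∧
      -- `PGL(2) → G` is an embedding, and `T̃ ≅ GL(1)`
      Function.Injective (GLFiveGLThree.rhoPGL R) ∧
      Function.Injective (GLFiveGLThree.tauT R) ∧
      -- in particular, the points of `G_w^0` over a field or a local ring
      (IsLocalRing R → GLFiveGLThree.identityComponent k R =
        {g | ∃ (x : Matrix.ProjGenLinGroup (Fin 2) R) (t : Rˣ),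
          g = GLFiveGLThree.rhoPGL R x * GLFiveGLThree.tauT R t}) := by
  have h2 : IsUnit (2 : R) := GLFiveGLThree.isUnit_ofNat_of_algebra k R 2
  have h3 : IsUnit (3 : R) := GLFiveGLThree.isUnit_ofNat_of_algebra k R 3
  rw [GLFiveGLThree.identityComponent_eq_stabilizerW]
  refine ⟨Set.ext fun g => GLFiveGLThree.mem_stabilizerW_iff_exists_mul h2 h3 g, ?_,
    GLFiveGLThree.pglSubgroup_inf_torusSubgroup, GLFiveGLThree.rhoPGL_injective h2,
    GLFiveGLThree.tauT_injective, fun _ => Set.ext fun g => ⟨fun hg => ?_, ?_⟩⟩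
  · rintro p - _ ⟨t, rfl⟩
    exact (GLFiveGLThree.tauT_commute t p).symm
  · obtain ⟨x, t, h⟩ := GLFiveGLThree.exists_rhoGL_mul_tauT h2 h3 hg
    exact ⟨.mk x, t, h⟩
  · rintro ⟨x, t, rfl⟩
    exact mul_mem (GLFiveGLThree.rhoPGL_mem_stabilizerW h2 x)
      (GLFiveGLThree.tauT_mem_stabilizerW h2 t)
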